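/- \textbf{Setting.} Let $\mathcal D_1$ be the open half-plane $\{(b,d)\in\mathbb R^2 : b<d\}$ together with a formal diagonal point $\ast$, with the bottleneck distance $d_{\mathcal B}(x,y)=\min\{\|x-y\|_\infty,\max(\tfrac{d_x-b_x}2,\tfrac{d_y-b_y}2)\}$ for $x=(b_x,d_x)$, $y=(b_y,d_y)$ off the diagonal, $d_{\mathcal B}(x,\ast)=\tfrac{d_x-b_x}2$ and $d_{\mathcal B}(\ast,\ast)=0$. Let $\mathcal D_n$ be the space of persistence diagrams on $n$ points, i.e. of multisets of $n$ elements of $\mathcal D_1$, with the bottleneck distance (the minimum over bijections of the largest distance of matched points) and its Borel $\sigma$-algebra. Let $\mathcal L=\{(p_j,r_j,w_j)\}_{j=1}^K$ be a fixed landmark configuration, $p_j\in\mathcal D_1$, $r_j>0$, $w_j>0$, $\sum_j w_j^2=1$, let $\Phi_j(A)=w_j\sum_{a\in A}\max\{r_j-d_{\mathcal B}(p_j,a),0\}$ for $A\in\mathcal D_n$, let $\sigma>0$, and let $$k_{\mathcal L}(A,B)=\sum_{j=1}^K\exp\Bigl(-\frac{(\Phi_j(A)-\Phi_j(B))^2}{2\sigma^2}\Bigr)$$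 be the landmark kernel, $\mathcal H$ its reproducing kernel Hilbert space and $\Phi^{\mathcal L}:\mathcal D_n\to\mathcal H$ the canonical feature map (so $\|\Phi^{\mathcal L}(A)\|=\sqrt K$ for all $A$). Let $k\ge2$ and let $(A,Y)$ have a distribution $\mathcal P$ on $\mathcal D_n\times\{1,\dots,k\}$ under which every class has positive probability. Put $\mu_c=\mathbb E[\Phi^{\mathcal L}(A)\mid Y=c]$ and let $\gamma=\tfrac12\min_{c\ne c'}\|\mu_c-\mu_{c'}\|_{\mathcal H}$ be the kernel margin. Given i.i.d. training samples $(A_1,y_1),\dots,(A_m,y_m)$ from $\mathcal P$, let $m_c$ be the number of samples with label $c$ and $m_{\min}=\min_c m_c$. For each pair $c<c'$ let $h_{cc'}(A)=\langle w_{cc'},\Phi^{\mathcal L}(A)\rangle_{\mathcal H}$, where $w_{cc'}=v/\|v\|$ (and $w_{cc'}=0$ if $v=0$) and $v\in\mathcal H$ is a maximum-margin SVM (linear in $\mathcal H$, without offset) for the training points of the classes $c$ (sign $+1$) and $c'$ (sign $-1$): either the hard-margin SVM, or the soft-margin SVM (hinge loss) for an arbitrary penalty parameter $C>0$. The one-vs-one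 classifier $\hat f$ predicts at $A$ a class with the largest number of votes, where $h_{cc'}$ votes for $c$ if $h_{cc'}(A)>0$ and for $c'$ otherwise; ties between classes are broken arbitrarily. Its $0$-$1$ risk is $\mathcal R(\hat f)=\mathbb P(\hat f(A)\ne Y)$. For $\rho>0$ let $\widehat{\mathcal R}_\rho(h_{cc'})$ be the fraction of the $m_c+m_{c'}$ training points of the classes $c,c'$ whose signed margin $\pm h_{cc'}(A_i)$ is below $\rho$, and let $\widehat{\mathcal R}_\rho(\hat f)=(k-1)\max_{c<c'}\widehat{\mathcal R}_\rho(h_{cc'})$. \textbf{Theorem.} There is an absolute constant $C_0>0$ such that the following holds for all such data with $\gamma>0$ and all $\delta\in(0,1)$. With probability at least $1-\delta$ over the draw of the training sample: if $$m_{\min}\ \ge\ \frac{32\,K\log(4k/\delta)}{\gamma^2},$$ then $$\mathcal R(\hat f)\ \le\ \widehat{\mathcal R}_{\gamma/2}(\hat f)+\frac{4(k-1)\sqrt K}{\gamma\sqrt{m_{\min}}}+C_0\sqrt{\frac{\log(k/\delta)}{m_{\min}}}.$$ -/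

import Mathlib

open MeasureTheory ProbabilityTheory

noncomputable section

/-! ### Persistence diagrams on `n` points and the bottleneck distance -/

/-- The space of one-point diagrams: a point `(birth, death)` of the open half-plane above the
diagonal, or the formal diagonal point `∗` (`none`). -/
def DiagramPoint : Type := Option {p : ℝ × ℝ // p.1 < p.2}

/-- The bottleneck distance of one-point diagrams. Two off-diagonal points are either matched to
each other, at their `ℓ^∞` distance, or both matched to the diagonal, each at half its
persistence. (`dist` on `ℝ × ℝ` is the `ℓ^∞` distance.) -/
def pointDist : DiagramPoint → DiagramPoint → ℝ
  | none, none => 0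
  | some x, none => (x.1.2 - x.1.1) / 2
  | none, some y => (y.1.2 - y.1.1) / 2
  | some x, some y =>
      min (dist x.1 y.1) (max ((x.1.2 - x.1.1) / 2) ((y.1.2 - y.1.1) / 2))

/-- Persistence diagrams on `n` points: multisets of `n` points of the half-plane above the
diagonal together with the formal diagonal point. A diagram with fewer than `n` off-diagonal
points is completed by copies of the diagonal point. -/
def Diagram (n : ℕ) : Type := Sym DiagramPoint n

/-- The bottleneck distance: the least `r` for which the points of `A` and `B` can be matched
bijectively at pointwise distance at most `r`. -/
def bottleneckDist {n : ℕ} (A B : Diagram n) : ℝ :=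
  sInf {r : ℝ | 0 ≤ r ∧ Multiset.Rel (fun x y => pointDist x y ≤ r) A.1 B.1}

/-- The topology of the bottleneck distance. -/
instance instTopologicalSpaceDiagram (n : ℕ) : TopologicalSpace (Diagram n) where
  IsOpen U := ∀ A ∈ U, ∃ ε > 0, ∀ B, bottleneckDist A B < ε → B ∈ U
  isOpen_univ := fun _ _ => ⟨1, one_pos, fun _ _ => trivial⟩
  isOpen_inter := by
    intro U V hU hV A hA
    obtain ⟨ε, hε, h⟩ := hU A hA.1
    obtain ⟨η, hη, h'⟩ := hV A hA.2
    exact ⟨min ε η, lt_min hε hη, fun B hB =>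
      ⟨h B (hB.trans_le (min_le_left _ _)), h' B (hB.trans_le (min_le_right _ _))⟩⟩
  isOpen_sUnion := by
    intro 𝒰 h A hA
    obtain ⟨U, hU, hAU⟩ := hA
    obtain ⟨ε, hε, h'⟩ := h U hU A hAU
    exact ⟨ε, hε, fun B hB => ⟨U, hU, h' B hB⟩⟩

/-- The Borel `σ`-algebra of the bottleneck distance. -/
instance instMeasurableSpaceDiagram (n : ℕ) : MeasurableSpace (Diagram n) := borel (Diagram n)

/-! ### Landmark configurations, the summation embedding and the landmark kernel -/

/-- A landmark configuration `{(p_j, r_j, w_j)}` with `K` landmarks. -/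
structure LandmarkConfig (K : ℕ) where
  /-- landmark positions -/
  pos : Fin K → DiagramPoint
  /-- support radii -/
  radius : Fin K → ℝ
  /-- weights -/
  weight : Fin K → ℝ
  radius_pos : ∀ j, 0 < radius j
  weight_pos : ∀ j, 0 < weight j
  sum_weight_sq : ∑ j, weight j ^ 2 = 1

/-- The coordinate function (pyramid) `x ↦ max (r - d_B(p, x)) 0`. -/
def coordFun (p : DiagramPoint) (r : ℝ) (x : DiagramPoint) : ℝ := max (r - pointDist p x) 0

/-- The summation landmark embedding, `Φ_j(A) = w_j ∑_{a ∈ A} max (r_j - d_B(p_j, a)) 0`. -/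
def sumEmbed {K n : ℕ} (L : LandmarkConfig K) (A : Diagram n) (j : Fin K) : ℝ :=
  L.weight j * (A.1.map (coordFun (L.pos j) (L.radius j))).sum

/-- The landmark kernel with bandwidth `σ`. -/
def landmarkKernel {K n : ℕ} (L : LandmarkConfig K) (σ : ℝ) (A B : Diagram n) : ℝ :=
  ∑ j, Real.exp (-(sumEmbed L A j - sumEmbed L B j) ^ 2 / (2 * σ ^ 2))

theorem landmarkKernel_comm {K n : ℕ} (L : LandmarkConfig K) (σ : ℝ) (A B : Diagram n) :
    landmarkKernel L σ A B = landmarkKernel L σ B A := by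
  unfold landmarkKernel
  refine Finset.sum_congr rfl fun j _ => ?_
  congr 2
  ring

/-- The one-dimensional Gaussian kernel is positive semidefinite. -/
theorem gaussian_kernel_nonneg {X : Type*} (g : X → ℝ) (σ : ℝ) (s : Finset X) (c : X → ℝ) :
    0 ≤ ∑ x ∈ s, ∑ y ∈ s, c x * c y * Real.exp (-(g x - g y) ^ 2 / (2 * σ ^ 2)) := by
  set v : NNReal := ⟨(σ ^ 2)⁻¹, by positivity⟩ with hv
  set μ := gaussianReal 0 v
  have key : ∀ x y, (Real.exp (-(g x - g y) ^ 2 / (2 * σ ^ 2)) : ℂ)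
      = ∫ t, Complex.exp ((t * g x : ℝ) * Complex.I)
          * (starRingEnd ℂ) (Complex.exp ((t * g y : ℝ) * Complex.I)) ∂μ := by
    intro x y
    have h := charFun_gaussianReal (μ := 0) (v := v) (g x - g y)
    rw [charFun_apply_real] at h
    have e1 : (Real.exp (-(g x - g y) ^ 2 / (2 * σ ^ 2)) : ℂ)
        = Complex.exp (((g x - g y : ℝ) : ℂ) * ((0 : ℝ) : ℂ) * Complex.I
            - ((v : ℝ) : ℂ) * ((g x - g y : ℝ) : ℂ) ^ 2 / 2) := by
      have : ((v : ℝ)) = (σ ^ 2)⁻¹ := rfl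
      rw [this, Complex.ofReal_exp]
      congr 1
      push_cast
      rw [mul_zero, zero_mul, zero_sub, mul_comm (2 : ℂ), ← div_div, div_eq_mul_inv _ ((σ : ℂ) ^ 2)]
      ring
    rw [e1, ← h]
    congr 1
    funext t
    rw [← Complex.exp_conj, ← Complex.exp_add]
    congr 1
    simp
    ring
  have hint : ∀ x y, Integrable (fun t : ℝ => Complex.exp ((t * g x : ℝ) * Complex.I)
          * (starRingEnd ℂ) (Complex.exp ((t * g y : ℝ) * Complex.I))) μ := by
    intro x y
    refine Integrable.of_bound (C := 1) (Continuous.aestronglyMeasurable (by fun_prop)) ?_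
    refine Filter.Eventually.of_forall fun t => ?_
    rw [norm_mul, RCLike.norm_conj, Complex.norm_exp_ofReal_mul_I, Complex.norm_exp_ofReal_mul_I,
      mul_one]
  have main : ((∑ x ∈ s, ∑ y ∈ s, c x * c y * Real.exp (-(g x - g y) ^ 2 / (2 * σ ^ 2)) : ℝ) : ℂ)
      = ((∫ t, Complex.normSq (∑ x ∈ s, c x * Complex.exp ((t * g x : ℝ) * Complex.I)) ∂μ : ℝ) : ℂ)
      := by
    rw [← integral_complex_ofReal]
    have : ∀ t : ℝ,
        (Complex.normSq (∑ x ∈ s, c x * Complex.exp ((t * g x : ℝ) * Complex.I)) : ℂ)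
        = ∑ x ∈ s, ∑ y ∈ s, ((c x * c y : ℝ) : ℂ) *
          (Complex.exp ((t * g x : ℝ) * Complex.I)
          * (starRingEnd ℂ) (Complex.exp ((t * g y : ℝ) * Complex.I))) := by
      intro t
      rw [← Complex.mul_conj, map_sum, Finset.sum_mul_sum]
      refine Finset.sum_congr rfl fun x _ => Finset.sum_congr rfl fun y _ => ?_
      rw [map_mul, Complex.conj_ofReal]
      push_cast
      ring
    simp_rw [this]
    rw [integral_finsetSum _ fun x _ => integrable_finsetSum _ fun y _ => (hint x y).const_mul _]
    rw [Complex.ofReal_sum]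
    refine Finset.sum_congr rfl fun x _ => ?_
    rw [integral_finsetSum _ fun y _ => (hint x y).const_mul _, Complex.ofReal_sum]
    refine Finset.sum_congr rfl fun y _ => ?_
    rw [integral_const_mul, ← key, Complex.ofReal_mul]
  rw [Complex.ofReal_inj] at main
  rw [main]
  exact integral_nonneg fun t => Complex.normSq_nonneg _

/-- The landmark kernel, with scalars regarded as operators on `ℝ`. -/
def landmarkKernelMatrix {K : ℕ} (n : ℕ) (L : LandmarkConfig K) (σ : ℝ) :
    Matrix (Diagram n) (Diagram n) (ℝ →L[ℝ] ℝ) :=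
  Matrix.of fun A B => landmarkKernel L σ A B • ContinuousLinearMap.id ℝ ℝ

instance fact_posSemidef_landmarkKernelMatrix {K : ℕ} (n : ℕ) (L : LandmarkConfig K) (σ : ℝ) :
    Fact (landmarkKernelMatrix n L σ).PosSemidef := by
  have tfae := (RKHS.posSemidef_tfae (K := landmarkKernelMatrix n L σ)).out 0 2
  refine ⟨tfae.mpr ⟨?_, fun c => ?_⟩⟩
  · ext A B
    have hid : star (ContinuousLinearMap.id ℝ ℝ) = ContinuousLinearMap.id ℝ ℝ :=
      star_one (ℝ →L[ℝ] ℝ)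
    simp [landmarkKernelMatrix, Matrix.conjTranspose_apply, landmarkKernel_comm L σ B A, hid]
  · have h : c.sum (fun A u => c.sum fun B v => inner ℝ (landmarkKernelMatrix n L σ B A u) v)
        = ∑ j, ∑ A ∈ c.support, ∑ B ∈ c.support, c A * c B *
          Real.exp (-(sumEmbed L A j - sumEmbed L B j) ^ 2 / (2 * σ ^ 2)) := by
      rw [Finset.sum_comm, Finsupp.sum]
      refine Finset.sum_congr rfl fun A _ => ?_
      rw [Finset.sum_comm, Finsupp.sum]
      refine Finset.sum_congr rfl fun B _ => ?_
      have e : inner ℝ (landmarkKernelMatrix n L σ B A (c A)) (c B)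
          = c A * c B * landmarkKernel L σ B A := by
        simp [landmarkKernelMatrix]
        ring
      rw [e, landmarkKernel, Finset.mul_sum]
      refine Finset.sum_congr rfl fun j _ => ?_
      congr 3
      ring
    rw [h, RCLike.re_to_real]
    exact Finset.sum_nonneg fun j _ => gaussian_kernel_nonneg _ σ _ _

/-- The reproducing kernel Hilbert space of the landmark kernel. -/
abbrev LandmarkRKHS {K : ℕ} (n : ℕ) (L : LandmarkConfig K) (σ : ℝ) : Type :=
  RKHS.OfKernel (landmarkKernelMatrix n L σ)

/-- The canonical feature map `A ↦ k(·, A)`. -/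
def featureMap {K n : ℕ} (L : LandmarkConfig K) (σ : ℝ) (A : Diagram n) : LandmarkRKHS n L σ :=
  RKHS.kerFun (LandmarkRKHS n L σ) A (1 : ℝ)

theorem inner_featureMap {K n : ℕ} (L : LandmarkConfig K) (σ : ℝ) (A B : Diagram n) :
    inner ℝ (featureMap L σ A) (featureMap L σ B) = landmarkKernel L σ A B := by
  rw [featureMap, featureMap, ← RKHS.kernel_inner, RKHS.OfKernel.kernel_ofKernel]
  simp [landmarkKernelMatrix, landmarkKernel_comm L σ B A]

/-! ### Class means and the kernel margin -/

/-- The class-conditional embedding mean `μ_c = E[Φ(A) | Y = c]`. -/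
def classMean {K n k : ℕ} (L : LandmarkConfig K) (σ : ℝ) (P : Measure (Diagram n × Fin k))
    (c : Fin k) : LandmarkRKHS n L σ :=
  ∫ z, featureMap L σ z.1 ∂(P[|{z | z.2 = c}])

/-- The population kernel margin `γ = ½ min_{c ≠ c'} ‖μ_c - μ_{c'}‖`. -/
def kernelMargin {K n k : ℕ} (L : LandmarkConfig K) (σ : ℝ) (P : Measure (Diagram n × Fin k)) :
    ℝ :=
  (1 / 2) * ⨅ q : {q : Fin k × Fin k // q.1 ≠ q.2},
    ‖classMean L σ P q.1.1 - classMean L σ P q.1.2‖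

/-! ### Training samples and one-vs-one support vector machines -/

/-- A labelled training sample of size `m`. -/
abbrev Sample (n k m : ℕ) : Type := Fin m → Diagram n × Fin k

/-- The number of training points in class `c`. -/
def classCount {n k m : ℕ} (S : Sample n k m) (c : Fin k) : ℕ :=
  (Finset.univ.filter fun i => (S i).2 = c).card

/-- The smallest class count `m_min = min_c m_c`. -/
def minClassCount {n k m : ℕ} (S : Sample n k m) : ℕ := ⨅ c, classCount S c

/-- The unordered pairs of distinct classes, written increasingly. Each indexes one binary
sub-problem, in which the first class is labelled `+1` and the second `-1`. -/
abbrev ClassPair (k : ℕ) : Type := {q : Fin k × Fin k // q.1 < q.2}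

/-- The training points that take part in the sub-problem `q`. -/
def pairIndices {n k m : ℕ} (S : Sample n k m) (q : ClassPair k) : Finset (Fin m) :=
  Finset.univ.filter fun i => (S i).2 = q.1.1 ∨ (S i).2 = q.1.2

/-- The signed margin `± ⟪v, Φ(A)⟫` of a point with label `y` in the sub-problem `q`. -/
def signedMargin {K n k : ℕ} (L : LandmarkConfig K) (σ : ℝ) (q : ClassPair k)
    (v : LandmarkRKHS n L σ) (z : Diagram n × Fin k) : ℝ :=
  (if z.2 = q.1.1 then 1 else -1) * inner ℝ v (featureMap L σ z.1)

/-- `v` solves the hard-margin problem: minimize `‖v‖` subject to all training points of the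
sub-problem having signed margin at least `1`. -/
def IsHardMarginSolution {K n k m : ℕ} (L : LandmarkConfig K) (σ : ℝ) (S : Sample n k m)
    (q : ClassPair k) (v : LandmarkRKHS n L σ) : Prop :=
  (∀ i ∈ pairIndices S q, 1 ≤ signedMargin L σ q v (S i)) ∧
    ∀ u : LandmarkRKHS n L σ, (∀ i ∈ pairIndices S q, 1 ≤ signedMargin L σ q u (S i)) → ‖v‖ ≤ ‖u‖

/-- The soft-margin objective `½‖v‖² + C ∑ max(0, 1 - signed margin)`. -/
def softMarginObjective {K n k m : ℕ} (L : LandmarkConfig K) (σ : ℝ) (S : Sample n k m)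
    (q : ClassPair k) (C : ℝ) (v : LandmarkRKHS n L σ) : ℝ :=
  (1 / 2) * ‖v‖ ^ 2 + C * ∑ i ∈ pairIndices S q, max 0 (1 - signedMargin L σ q v (S i))

/-- `w` is the unit-norm direction `v / ‖v‖` of a maximum-margin SVM `v` for the sub-problem `q`:
either the hard-margin SVM, or the soft-margin SVM for some penalty `C > 0`
(`w = 0` in case `v = 0`). -/
def IsMaxMarginSVM {K n k m : ℕ} (L : LandmarkConfig K) (σ : ℝ) (S : Sample n k m)
    (q : ClassPair k) (w : LandmarkRKHS n L σ) : Prop :=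
  ∃ v : LandmarkRKHS n L σ,
    (IsHardMarginSolution L σ S q v ∨
      ∃ C : ℝ, 0 < C ∧ ∀ u, softMarginObjective L σ S q C v ≤ softMarginObjective L σ S q C u) ∧
    w = ‖v‖⁻¹ • v

/-- The class for which the binary classifier of the sub-problem `q` votes at `A`. -/
def pairPredict {K n k : ℕ} (L : LandmarkConfig K) (σ : ℝ) (w : ClassPair k → LandmarkRKHS n L σ)
    (q : ClassPair k) (A : Diagram n) : Fin k :=
  if 0 < inner ℝ (w q) (featureMap L σ A) then q.1.1 else q.1.2

/-- The number of votes for class `c` at `A`. -/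
def votes {K n k : ℕ} (L : LandmarkConfig K) (σ : ℝ) (w : ClassPair k → LandmarkRKHS n L σ)
    (A : Diagram n) (c : Fin k) : ℕ :=
  (Finset.univ.filter fun q : ClassPair k => pairPredict L σ w q A = c).card

/-- `f` is a one-vs-one maximum-margin SVM trained on `S`, with binary classifiers `w`: it predicts
by majority vote, ties being broken in any way. -/
structure IsOvOSVM {K n k m : ℕ} (L : LandmarkConfig K) (σ : ℝ) (S : Sample n k m)
    (w : ClassPair k → LandmarkRKHS n L σ) (f : Diagram n → Fin k) : Prop where
  maxMargin : ∀ q, IsMaxMarginSVM L σ S q (w q)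
  majority : ∀ A c, votes L σ w A c ≤ votes L σ w A (f A)

/-! ### Risks -/

/-- The generalization `0`-`1` risk. -/
def zeroOneRisk {n k : ℕ} (P : Measure (Diagram n × Fin k)) (f : Diagram n → Fin k) : ℝ :=
  P.real {z | f z.1 ≠ z.2}

/-- The empirical `ρ`-margin loss of one binary classifier: the fraction of the training points of
the sub-problem whose signed margin is below `ρ`. -/
def pairMarginLoss {K n k m : ℕ} (L : LandmarkConfig K) (σ : ℝ) (S : Sample n k m)
    (q : ClassPair k) (ρ : ℝ) (w : LandmarkRKHS n L σ) : ℝ :=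
  (((pairIndices S q).filter fun i => signedMargin L σ q w (S i) < ρ).card : ℝ) /
    ((pairIndices S q).card : ℝ)

/-- The empirical `ρ`-margin loss of the one-vs-one classifier, `(k - 1) max_{c ≠ c'}` of the
losses of the binary classifiers. -/
def empiricalMarginLoss {K n k m : ℕ} (L : LandmarkConfig K) (σ : ℝ) (S : Sample n k m) (ρ : ℝ)
    (w : ClassPair k → LandmarkRKHS n L σ) : ℝ :=
  ((k : ℝ) - 1) * ⨆ q : ClassPair k, pairMarginLoss L σ S q ρ (w q)

end

/-! If the majority vote errs at `(A, Y)`, then some binary classifier involving `Y` has nonpositive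
signed margin: otherwise `Y` collects all `k - 1` of its votes, and every rival, having lost to `Y`,
collects fewer (`exists_signedMargin_nonpos`). With `ρ = γ / 2`, the error indicator is therefore at
most the sum, over the pairs involving `Y`, of ramp losses of margin divided by `ρ`. This sum is
capped at `1`, so that it concentrates as a single loss in `[0, 1]`: the deviation term carries no
factor `k` and needs no union bound over pairs.

The rest is a margin bound for this one loss, uniform over families of functionals in the unit ball
(`exists_uniform_margin_event`). McDiarmid's inequality is applied to the uniform deviation minus
its empirical Rademacher average, whose mean is nonpositive by symmetrization. Contraction and
subadditivity bound that average by `2 (√K / ρ) ∑ √N_q`, where `N_q` is the number of training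
points in the pair `q` (`radSup_cappedLoss_le`). As `N_q` stays empirical, there is no need to
condition on the labels. The supremum over the ball is reached through a dense sequence, since the
Hilbert space is separable.

Double counting gives `∑ N_q = m (k - 1)`. Hence the empirical loss is at most `m (k - 1)` times the
largest pair loss, and `√N_q ≤ N_q / √m_min` produces the complexity term.

Rademacher averages are defined by recursion on the signs, with an offset `a` collecting the terms
already signed; the inductions run one observation at a time over arbitrary offsets. -/

/-! ### Rademacher averages of suprema over a finite index type -/

section RadSup

variable {ι : Type*}

/-- The Rademacher average `𝔼_ε sup_t (a t + ∑ i, ε i * b i t)` over independent uniform signs. -/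
noncomputable def radSup : {m : ℕ} → (ι → ℝ) → (Fin m → ι → ℝ) → ℝ
  | 0, a, _ => ⨆ t, a t
  | _ + 1, a, b =>
      (radSup (a + b 0) (fun i => b i.succ) + radSup (a - b 0) (fun i => b i.succ)) / 2

theorem radSup_zero (a : ι → ℝ) (b : Fin 0 → ι → ℝ) : radSup a b = ⨆ t, a t := rfl

theorem radSup_succ {m : ℕ} (a : ι → ℝ) (b : Fin (m + 1) → ι → ℝ) :
    radSup a b =
      (radSup (a + b 0) (fun i => b i.succ) + radSup (a - b 0) (fun i => b i.succ)) / 2 := rfl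

theorem measurable_radSup [Finite ι] {Ω : Type*} [MeasurableSpace Ω] {m : ℕ}
    {a : ι → Ω → ℝ} {b : Fin m → ι → Ω → ℝ}
    (ha : ∀ t, Measurable (a t)) (hb : ∀ i t, Measurable (b i t)) :
    Measurable fun ω => radSup (fun t => a t ω) (fun i t => b i t ω) := by
  induction m generalizing a with
  | zero => exact Measurable.iSup ha
  | succ m ih =>
    exact ((ih (a := fun t ω => a t ω + b 0 t ω) (fun t => (ha t).add (hb 0 t))
      (fun i t => hb i.succ t)).add
      (ih (a := fun t ω => a t ω - b 0 t ω) (fun t => (ha t).sub (hb 0 t))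
      (fun i t => hb i.succ t))).div_const 2

/-- The Rademacher complexity of a family of linear functionals of norm at most `1`. -/
theorem radSup_inner_le {H : Type*} [NormedAddCommGroup H] [InnerProductSpace ℝ H]
    [Nonempty ι] {m : ℕ} {w : ι → H} (hw : ∀ t, ‖w t‖ ≤ 1) (x : H) (v : Fin m → H) :
    radSup (fun t => inner ℝ (w t) x) (fun i t => inner ℝ (w t) (v i)) ≤
      √(‖x‖ ^ 2 + ∑ i, ‖v i‖ ^ 2) := by
  induction m generalizing x with
  | zero =>
    refine ciSup_le fun t => ?_
    simp only [Finset.univ_eq_empty, Finset.sum_empty, add_zero, Real.sqrt_sq (norm_nonneg x)]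
    exact (real_inner_le_norm _ _).trans (mul_le_of_le_one_left (norm_nonneg _) (hw t))
  | succ m ih =>
    have h1 := ih (x + v 0) (fun i => v i.succ)
    have h2 := ih (x - v 0) (fun i => v i.succ)
    simp only [inner_add_right, inner_sub_right] at h1 h2
    have hs : 0 ≤ ∑ i : Fin m, ‖v i.succ‖ ^ 2 := by positivity
    rw [radSup_succ, Fin.sum_univ_succ]
    set s := ∑ i : Fin m, ‖v i.succ‖ ^ 2
    refine (div_le_div_of_nonneg_right (add_le_add h1 h2) zero_le_two).trans ?_
    apply Real.le_sqrt_of_sq_le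
    have e1 := Real.sq_sqrt (show 0 ≤ ‖x + v 0‖ ^ 2 + s by positivity)
    have e2 := Real.sq_sqrt (show 0 ≤ ‖x - v 0‖ ^ 2 + s by positivity)
    have e3 := parallelogram_law_with_norm ℝ x (v 0)
    -- The mean of the two roots is at most their quadratic mean; by the parallelogram law the cross
    -- terms cancel in the latter.
    nlinarith [sq_nonneg (√(‖x + v 0‖ ^ 2 + s) - √(‖x - v 0‖ ^ 2 + s))]

variable [Finite ι] [Nonempty ι]

/-- For every sign pattern the function of `t` grows by at most `D + ∑ d i`. This supplies both the
a priori bounds and the bounded differences for McDiarmid's inequality. -/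
theorem radSup_le_radSup_add {m : ℕ} {a a' : ι → ℝ} {b b' : Fin m → ι → ℝ} {D : ℝ} {d : Fin m → ℝ}
    (ha : ∀ t, a t ≤ a' t + D) (hb : ∀ i t, |b i t - b' i t| ≤ d i) :
    radSup a b ≤ radSup a' b' + (D + ∑ i, d i) := by
  induction m generalizing a a' D with
  | zero =>
    simp only [radSup_zero, Finset.univ_eq_empty, Finset.sum_empty, add_zero]
    exact ciSup_le fun t => (ha t).trans
      (by gcongr; exact le_ciSup (f := a') (Set.finite_range a').bddAbove t)
  | succ m ih =>
    have h1 := ih (a := a + b 0) (a' := a' + b' 0) (D := D + d 0) (d := fun i => d i.succ)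
      (fun t => by
        have := abs_le.1 (hb 0 t); have := ha t; simp only [Pi.add_apply]; linarith)
      (fun i t => hb i.succ t)
    have h2 := ih (a := a - b 0) (a' := a' - b' 0) (D := D + d 0) (d := fun i => d i.succ)
      (fun t => by
        have := abs_le.1 (hb 0 t); have := ha t; simp only [Pi.sub_apply]; linarith)
      (fun i t => hb i.succ t)
    rw [radSup_succ, radSup_succ, Fin.sum_univ_succ]
    linarith

/-- Replacing the two-point average of `±b` by that of `±b'` increases a Rademacher average if `b'`
separates points at least as much as `b`. -/
theorem radSup_add_radSup_sub_le {m : ℕ} (a : ι → ℝ) {b b' : ι → ℝ} (c : Fin m → ι → ℝ)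
    (h : ∀ s t, |b s - b t| ≤ |b' s - b' t|) :
    radSup (a + b) c + radSup (a - b) c ≤ radSup (a + b') c + radSup (a - b') c := by
  induction m generalizing a with
  | zero =>
    simp only [radSup_zero]
    have hp := fun t => le_ciSup (f := fun t => (a + b') t) (Set.finite_range _).bddAbove t
    have hm := fun t => le_ciSup (f := fun t => (a - b') t) (Set.finite_range _).bddAbove t
    -- The two suprema are attained independently, at `s` for the sign `+` and at `t` for the sign
    -- `-`.
    rw [← le_sub_iff_add_le]
    refine ciSup_le fun s => ?_
    rw [le_sub_comm]
    refine ciSup_le fun t => ?_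
    have h1 := (le_abs_self _).trans (h s t)
    have := hp s; have := hp t; have := hm s; have := hm t
    simp only [Pi.add_apply, Pi.sub_apply] at *
    -- If `b' s ≥ b' t`, the points keep their signs; otherwise `s` and `t` exchange roles.
    rcases abs_cases (b' s - b' t) with h2 | h2 <;> linarith
  | succ m ih =>
    have h1 := ih (a + c 0) (fun i => c i.succ)
    have h2 := ih (a - c 0) (fun i => c i.succ)
    simp only [radSup_succ]
    rw [show a + b + c 0 = a + c 0 + b by abel, show a + b - c 0 = a - c 0 + b by abel,
      show a - b + c 0 = a + c 0 - b by abel, show a - b - c 0 = a - c 0 - b by abel,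
      show a + b' + c 0 = a + c 0 + b' by abel, show a + b' - c 0 = a - c 0 + b' by abel,
      show a - b' + c 0 = a + c 0 - b' by abel, show a - b' - c 0 = a - c 0 - b' by abel]
    linarith

/-- The Ledoux–Talagrand contraction principle. -/
theorem radSup_contraction {m : ℕ} (a : ι → ℝ) {b b' : Fin m → ι → ℝ}
    (h : ∀ i s t, |b i s - b i t| ≤ |b' i s - b' i t|) : radSup a b ≤ radSup a b' := by
  induction m generalizing a with
  | zero => rfl
  | succ m ih =>
    rw [radSup_succ, radSup_succ]
    have h1 := ih (b := fun i => b i.succ) (b' := fun i => b' i.succ) (a + b 0) (fun i => h i.succ)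
    have h2 := ih (b := fun i => b i.succ) (b' := fun i => b' i.succ) (a - b 0) (fun i => h i.succ)
    -- The induction hypothesis has already replaced the later coordinates, so the first one is
    -- exchanged in front of the tail of `b'`.
    have h3 := radSup_add_radSup_sub_le a (fun i => b' i.succ) (h 0)
    linarith

/-- For each sign pattern the supremum of a sum is at most the sum of the suprema. It separates the
binary sub-problems. -/
theorem radSup_sum_le {Q : Type*} [Fintype Q] {m : ℕ} (a : Q → ι → ℝ) (b : Q → Fin m → ι → ℝ) :
    radSup (fun t => ∑ q, a q t) (fun i t => ∑ q, b q i t) ≤ ∑ q, radSup (a q) (b q) := by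
  induction m generalizing a with
  | zero =>
    exact ciSup_le fun t => Finset.sum_le_sum fun q _ =>
      le_ciSup (f := a q) (Set.finite_range _).bddAbove t
  | succ m ih =>
    have h1 := ih (fun q => a q + b q 0) (fun q i => b q i.succ)
    have h2 := ih (fun q => a q - b q 0) (fun q i => b q i.succ)
    simp only [Pi.add_apply, Pi.sub_apply, Finset.sum_add_distrib, Finset.sum_sub_distrib] at h1 h2
    simp only [radSup_succ, ← Finset.sum_div, Finset.sum_add_distrib]
    exact div_le_div_of_nonneg_right (add_le_add h1 h2) zero_le_two

/-- Convexity in the offset: `a + x - y` is the midpoint of `a + 2x` and `a - 2y`. In symmetrization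
this splits a ghost difference into two signed halves, and is the origin of the factor `2`. -/
theorem radSup_midpoint_le {m : ℕ} (a x y : ι → ℝ) (c : Fin m → ι → ℝ) :
    radSup (a + x - y) c ≤
      (radSup (a + (2 : ℝ) • x) c + radSup (a - (2 : ℝ) • y) c) / 2 := by
  induction m generalizing a with
  | zero =>
    refine ciSup_le fun t => ?_
    have h1 := le_ciSup (f := fun t => (a + (2 : ℝ) • x) t) (Set.finite_range _).bddAbove t
    have h2 := le_ciSup (f := fun t => (a - (2 : ℝ) • y) t) (Set.finite_range _).bddAbove t
    simp only [radSup_zero, Pi.add_apply, Pi.sub_apply, Pi.smul_apply, smul_eq_mul] at *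
    linarith
  | succ m ih =>
    have h1 := ih (a + c 0) (fun i => c i.succ)
    have h2 := ih (a - c 0) (fun i => c i.succ)
    simp only [radSup_succ]
    rw [show a + x - y + c 0 = a + c 0 + x - y by abel,
      show a + x - y - c 0 = a - c 0 + x - y by abel,
      show a + (2 : ℝ) • x + c 0 = a + c 0 + (2 : ℝ) • x by abel,
      show a + (2 : ℝ) • x - c 0 = a - c 0 + (2 : ℝ) • x by abel,
      show a - (2 : ℝ) • y + c 0 = a + c 0 - (2 : ℝ) • y by abel,
      show a - (2 : ℝ) • y - c 0 = a - c 0 - (2 : ℝ) • y by abel]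
    linarith

theorem abs_radSup_le {m : ℕ} {a : ι → ℝ} {b : Fin m → ι → ℝ} {D d : ℝ}
    (ha : ∀ t, |a t| ≤ D) (hb : ∀ i t, |b i t| ≤ d) : |radSup a b| ≤ D + m * d := by
  have h0 : radSup (0 : ι → ℝ) (0 : Fin m → ι → ℝ) = 0 := by
    clear ha hb b
    induction m with
    | zero => simp [radSup_zero]
    | succ m ih =>
      rw [radSup_succ]
      have e : (fun i => (0 : Fin (m + 1) → ι → ℝ) (Fin.succ i)) = 0 := rfl
      rw [e, Pi.zero_apply, add_zero, sub_zero, ih, add_zero, zero_div]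
  have h1 := radSup_le_radSup_add (a := a) (a' := 0) (b := b) (b' := 0) (D := D) (d := fun _ => d)
    (fun t => by simpa using (abs_le.1 (ha t)).2) (by simpa using hb)
  have h2 := radSup_le_radSup_add (a := 0) (a' := a) (b := 0) (b' := b) (D := D) (d := fun _ => d)
    (fun t => by have := (abs_le.1 (ha t)).1; simp only [Pi.zero_apply]; linarith) (by simpa using hb)
  simp only [h0, Finset.sum_const, Finset.card_univ, Fintype.card_fin, nsmul_eq_mul] at h1 h2
  rw [abs_le]; constructor <;> linarith

theorem integrable_radSup {Ω : Type*} [MeasurableSpace Ω] {μ : Measure Ω} [IsFiniteMeasure μ]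
    {m : ℕ} {a : ι → Ω → ℝ} {b : Fin m → ι → Ω → ℝ} {D d : ℝ}
    (ha : ∀ t, Measurable (a t)) (hb : ∀ i t, Measurable (b i t))
    (haD : ∀ t ω, |a t ω| ≤ D) (hbd : ∀ i t ω, |b i t ω| ≤ d) :
    Integrable (fun ω => radSup (fun t => a t ω) (fun i t => b i t ω)) μ :=
  Integrable.of_bound (measurable_radSup ha hb).aestronglyMeasurable (D + m * d)
    (Filter.Eventually.of_forall fun ω => abs_radSup_le (fun t => haD t ω) (fun i t => hbd i t ω))

/-- Jensen's inequality for the convex function `radSup · c`. -/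
theorem radSup_add_integral_le {Ω : Type*} [MeasurableSpace Ω] {μ : Measure Ω}
    [IsProbabilityMeasure μ] {m : ℕ} (a : ι → ℝ) {x : ι → Ω → ℝ} (c : Fin m → ι → ℝ) {D : ℝ}
    (hx : ∀ t, Measurable (x t)) (hxD : ∀ t ω, |x t ω| ≤ D) :
    radSup (fun t => a t + ∫ ω, x t ω ∂μ) c ≤ ∫ ω, radSup (fun t => a t + x t ω) c ∂μ := by
  obtain ⟨A, hA⟩ := (Set.finite_range fun t => |a t|).bddAbove
  replace hA : ∀ t, |a t| ≤ A := fun t => hA ⟨t, rfl⟩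
  obtain ⟨d, hd⟩ := (Set.finite_range fun p : Fin m × ι => |c p.1 p.2|).bddAbove
  replace hd : ∀ i t, |c i t| ≤ d := fun i t => hd ⟨(i, t), rfl⟩
  induction m generalizing a A with
  | zero =>
    refine ciSup_le fun t => ?_
    have hi : Integrable (x t) μ := Integrable.of_bound (hx t).aestronglyMeasurable D
      (Filter.Eventually.of_forall fun ω => hxD t ω)
    calc a t + ∫ ω, x t ω ∂μ = ∫ ω, (a t + x t ω) ∂μ := by
          rw [integral_add (integrable_const _) hi]; simp
      _ ≤ _ := by
          refine integral_mono ((integrable_const _).add hi)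
            (integrable_radSup (D := A + D) (d := d) (a := fun t ω => a t + x t ω)
              (b := fun i t _ => c i t) (fun t => (hx t).const_add _) (fun _ _ => measurable_const)
              (fun t ω => (abs_add_le _ _).trans (add_le_add (hA t) (hxD t ω)))
              (fun i t _ => hd i t)) fun ω => ?_
          exact le_ciSup (f := fun t => a t + x t ω) (Set.finite_range _).bddAbove t
  | succ m ih =>
    have hA1 : ∀ t, |(a + c 0) t| ≤ A + d := fun t =>
      (abs_add_le _ _).trans (add_le_add (hA t) (hd 0 t))
    have hA2 : ∀ t, |(a - c 0) t| ≤ A + d := fun t =>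
      (abs_sub _ _).trans (add_le_add (hA t) (hd 0 t))
    have h1 := ih (a + c 0) (fun i => c i.succ) (A + d) hA1 (fun i => hd i.succ)
    have h2 := ih (a - c 0) (fun i => c i.succ) (A + d) hA2 (fun i => hd i.succ)
    have hi : ∀ a' : ι → ℝ, (∀ t, |a' t| ≤ A + d) →
        Integrable (fun ω => radSup (fun t => a' t + x t ω) (fun i => c i.succ)) μ := fun a' ha' =>
      integrable_radSup (D := A + d + D) (d := d) (a := fun t ω => a' t + x t ω)
        (b := fun i t _ => c i.succ t) (fun t => (hx t).const_add _) (fun _ _ => measurable_const)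
        (fun t ω => (abs_add_le _ _).trans (add_le_add (ha' t) (hxD t ω)))
        (fun i t _ => hd i.succ t)
    simp only [radSup_succ, integral_div]
    have e1 : ∀ y : ι → ℝ, (fun t => a t + y t) + c 0 = fun t => (a + c 0) t + y t := fun y => by
      funext t; simp only [Pi.add_apply]; ring
    have e2 : ∀ y : ι → ℝ, (fun t => a t + y t) - c 0 = fun t => (a - c 0) t + y t := fun y => by
      funext t; simp only [Pi.sub_apply]; ring
    simp only [e1, e2]
    rw [integral_add (hi _ hA1) (hi _ hA2)]
    linarith

end RadSup

/-! ### Bounded differences and symmetrization for product measures -/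

section ProductMeasure

variable {Z : Type*} [MeasurableSpace Z]

theorem measurable_fin_cons {m : ℕ} :
    Measurable fun p : Z × (Fin m → Z) => (Fin.cons p.1 p.2 : Fin (m + 1) → Z) := by
  refine measurable_pi_iff.2 fun i => ?_
  refine Fin.cases ?_ (fun j => ?_) i
  · simpa using measurable_fst
  · simpa [Function.comp_def] using (measurable_pi_apply j).comp (measurable_snd (α := Z))

theorem integrable_of_measurable_of_abs_le {Ω : Type*} [MeasurableSpace Ω] {μ : Measure Ω}
    [IsFiniteMeasure μ] {f : Ω → ℝ} {M : ℝ} (hf : Measurable f) (hM : ∀ ω, |f ω| ≤ M) :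
    Integrable f μ :=
  Integrable.of_bound hf.aestronglyMeasurable M (Filter.Eventually.of_forall hM)

variable (P : Measure Z) [IsProbabilityMeasure P]

/-- Fubini, splitting off the first observation; it drives the inductions on the sample size. -/
theorem integral_pi_fin_succ {m : ℕ} {f : (Fin (m + 1) → Z) → ℝ} {M : ℝ} (hf : Measurable f)
    (hM : ∀ S, |f S| ≤ M) :
    ∫ S, f S ∂Measure.pi (fun _ : Fin (m + 1) => P) =
      ∫ z, ∫ S, f (Fin.cons z S) ∂Measure.pi (fun _ : Fin m => P) ∂P := by
  have h := (measurePreserving_piFinSuccAbove (fun _ : Fin (m + 1) => P) 0).symm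
  rw [← h.integral_comp', integral_prod]
  · refine integral_congr_ae (Filter.Eventually.of_forall fun z => integral_congr_ae
      (Filter.Eventually.of_forall fun S => congrArg f ?_))
    exact Fin.insertNth_zero' z S
  · exact integrable_of_measurable_of_abs_le (hf.comp (MeasurableEquiv.measurable _)) fun _ => hM _

variable {P}

theorem abs_integral_le_of_abs_le {Ω : Type*} [MeasurableSpace Ω] {μ : Measure Ω}
    [IsProbabilityMeasure μ] {f : Ω → ℝ} {M : ℝ} (hM : ∀ ω, |f ω| ≤ M) : |∫ ω, f ω ∂μ| ≤ M := by
  simpa using norm_integral_le_of_norm_le_const (μ := μ) (f := f) (C := M)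
    (Filter.Eventually.of_forall hM)

/-- McDiarmid's inequality, in terms of the moment generating function. -/
theorem integral_exp_le_of_bounded_differences {m : ℕ} {f : (Fin m → Z) → ℝ} {M c : ℝ}
    (hf : Measurable f) (hM : ∀ S, |f S| ≤ M)
    (hc : ∀ S i z, |f (Function.update S i z) - f S| ≤ c) (l : ℝ) :
    ∫ S, Real.exp (l * (f S - ∫ T, f T ∂Measure.pi (fun _ : Fin m => P)))
      ∂Measure.pi (fun _ : Fin m => P) ≤ Real.exp (m * (l ^ 2 * c ^ 2 / 8)) := by
  induction m with
  | zero =>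
    have : ∀ S : Fin 0 → Z, f S = f Fin.elim0 := fun S => by rw [Subsingleton.elim S]
    simp [this]
  | succ m ih =>
    set E := ∫ T, f T ∂Measure.pi (fun _ : Fin (m + 1) => P) with hE
    have hf' : Measurable fun p : Z × (Fin m → Z) => f (Fin.cons p.1 p.2) :=
      hf.comp measurable_fin_cons
    -- The conditional mean given the first observation. It oscillates by at most `c`, so
    -- Hoeffding's lemma applies to it, while the induction hypothesis controls `f` around it.
    set g : Z → ℝ := fun z => ∫ S, f (Fin.cons z S) ∂Measure.pi (fun _ : Fin m => P) with hg
    have hgm : Measurable g := (hf'.stronglyMeasurable.integral_prod_right).measurable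
    have hgM : ∀ z, |g z| ≤ M := fun z => abs_integral_le_of_abs_le fun S => hM _
    have hfz : ∀ z, Measurable fun S : Fin m → Z => f (Fin.cons z S) := fun z =>
      hf'.comp measurable_prodMk_left
    have hEg : E = ∫ z, g z ∂P := integral_pi_fin_succ P hf hM
    have hEM : |E| ≤ M := abs_integral_le_of_abs_le hM
    obtain ⟨z₀⟩ : Nonempty Z := P.nonempty_of_neZero
    have hgc : ∀ z z', g z' ≤ g z + c := fun z z' => by
      have h1 : g z + c = ∫ S, (f (Fin.cons z S) + c) ∂Measure.pi (fun _ : Fin m => P) := by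
        rw [integral_add (integrable_of_measurable_of_abs_le (hfz z) fun _ => hM _)
          (integrable_const _)]
        simp [hg]
      rw [h1]
      refine integral_mono (integrable_of_measurable_of_abs_le (hfz z') fun _ => hM _)
        ((integrable_of_measurable_of_abs_le (hfz z) fun _ => hM _).add (integrable_const _))
        fun S => ?_
      have := (abs_le.1 (hc (Fin.cons z S) 0 z')).2
      rw [Fin.update_cons_zero] at this
      linarith
    have hbdd : BddBelow (Set.range g) := ⟨-M, by
      rintro _ ⟨z, rfl⟩; exact (abs_le.1 (hgM z)).1⟩
    have hIcc : ∀ z, g z ∈ Set.Icc (⨅ z, g z) ((⨅ z, g z) + c) := fun z => by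
      refine ⟨ciInf_le hbdd z, ?_⟩
      have : Nonempty Z := ⟨z₀⟩
      rw [← sub_le_iff_le_add]
      exact le_ciInf fun z' => by linarith [hgc z' z]
    have hoeff := (hasSubgaussianMGF_of_mem_Icc (μ := P) hgm.aemeasurable
      (Filter.Eventually.of_forall hIcc)).mgf_le l
    rw [← hEg] at hoeff
    -- An interval of length `c` has sub-Gaussian variance proxy `(c / 2) ^ 2`, whence the `8`.
    have hcoef : (((‖(⨅ z, g z) + c - ⨅ z, g z‖₊ / 2) ^ 2 : NNReal) : ℝ) * l ^ 2 / 2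
        = l ^ 2 * c ^ 2 / 8 := by
      push_cast
      rw [add_sub_cancel_left, Real.norm_eq_abs, div_pow, sq_abs]
      ring
    rw [hcoef] at hoeff
    have hexpM : ∀ x y : ℝ, |x| ≤ M → |y| ≤ M →
        |Real.exp (l * (x - y))| ≤ Real.exp (|l| * (2 * M)) := fun x y hx hy => by
      rw [Real.abs_exp, Real.exp_le_exp]
      refine (le_abs_self _).trans ?_
      rw [abs_mul]
      gcongr
      exact (abs_sub _ _).trans (by linarith)
    rw [integral_pi_fin_succ P (by fun_prop) fun S => hexpM _ _ (hM S) hEM]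
    calc ∫ z, ∫ S, Real.exp (l * (f (Fin.cons z S) - E)) ∂Measure.pi (fun _ : Fin m => P) ∂P
        ≤ ∫ z, Real.exp (m * (l ^ 2 * c ^ 2 / 8)) * Real.exp (l * (g z - E)) ∂P := by
          refine integral_mono ?_ ?_ fun z => ?_
          · refine integrable_of_measurable_of_abs_le (M := Real.exp (|l| * (2 * M))) ?_ fun z =>
              abs_integral_le_of_abs_le fun S => hexpM _ _ (hM _) hEM
            exact (Measurable.stronglyMeasurable (((hf'.sub_const E).const_mul
              l).exp)).integral_prod_right.measurable
          · exact (integrable_of_measurable_of_abs_le (by fun_prop) fun z =>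
              hexpM _ _ (hgM z) hEM).const_mul _
          · have h := ih (hfz z) (fun S => hM _) fun S i x => by
              have := hc (Fin.cons z S) i.succ x
              rwa [← Fin.cons_update] at this
            have e : ∀ S : Fin m → Z, Real.exp (l * (f (Fin.cons z S) - E))
                = Real.exp (l * (f (Fin.cons z S) - g z)) * Real.exp (l * (g z - E)) := fun S => by
              rw [← Real.exp_add]; congr 1; ring
            simp only [e, integral_mul_const]
            gcongr
      _ = Real.exp (m * (l ^ 2 * c ^ 2 / 8)) * ∫ z, Real.exp (l * (g z - E)) ∂P :=
          integral_const_mul _ _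
      _ ≤ Real.exp (m * (l ^ 2 * c ^ 2 / 8)) * Real.exp (l ^ 2 * c ^ 2 / 8) := by
          gcongr
          exact hoeff
      _ = Real.exp ((m + 1 : ℕ) * (l ^ 2 * c ^ 2 / 8)) := by
          rw [← Real.exp_add]; congr 1; push_cast; ring

/-- McDiarmid's inequality. -/
theorem measure_ge_le_of_bounded_differences {m : ℕ} (hm : 0 < m) {f : (Fin m → Z) → ℝ} {M c : ℝ}
    (hf : Measurable f) (hM : ∀ S, |f S| ≤ M) (hc0 : 0 < c)
    (hc : ∀ S i z, |f (Function.update S i z) - f S| ≤ c)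
    (hmean : ∫ S, f S ∂Measure.pi (fun _ : Fin m => P) ≤ 0) {t : ℝ} (ht : 0 ≤ t) :
    (Measure.pi (fun _ : Fin m => P)).real {S | t ≤ f S} ≤
      Real.exp (-2 * t ^ 2 / (m * c ^ 2)) := by
  set μ := Measure.pi (fun _ : Fin m => P)
  set E := ∫ S, f S ∂μ
  have hm' : (0 : ℝ) < m := by exact_mod_cast hm
  have hEM : |E| ≤ M := abs_integral_le_of_abs_le hM
  -- The minimizer of `-l * t + m * l ^ 2 * c ^ 2 / 8`.
  set l := 4 * t / (m * c ^ 2) with hl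
  have hl0 : 0 ≤ l := by positivity
  have hint : Integrable (fun S => Real.exp (l * (f S - E))) μ :=
    integrable_of_measurable_of_abs_le (M := Real.exp (l * (2 * M))) (by fun_prop) fun S => by
      rw [Real.abs_exp, Real.exp_le_exp]
      gcongr
      linarith [(abs_le.1 (hM S)).2, (abs_le.1 hEM).1]
  have h1 := measure_ge_le_exp_mul_mgf (μ := μ) (X := fun S => f S - E) t hl0 hint
  have h2 : mgf (fun S => f S - E) μ l ≤ Real.exp (m * (l ^ 2 * c ^ 2 / 8)) :=
    integral_exp_le_of_bounded_differences hf hM hc l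
  calc μ.real {S | t ≤ f S} ≤ μ.real {S | t ≤ f S - E} :=
        measureReal_mono fun S (hS : t ≤ f S) => show t ≤ f S - E by linarith
    _ ≤ Real.exp (-l * t) * Real.exp (m * (l ^ 2 * c ^ 2 / 8)) := h1.trans (by gcongr)
    _ = Real.exp (-2 * t ^ 2 / (m * c ^ 2)) := by
        rw [← Real.exp_add]
        congr 1
        rw [hl]
        field_simp
        ring

/-- Symmetrization. -/
theorem integral_iSup_le_integral_radSup {ι : Type*} [Finite ι] [Nonempty ι] {m : ℕ} (a : ι → ℝ)
    {x : ι → Z → ℝ} {D : ℝ} (hx : ∀ t, Measurable (x t)) (hD : ∀ t z, |x t z| ≤ D) :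
    ∫ S, ⨆ t, (a t + ∑ i, (∫ z, x t z ∂P - x t (S i))) ∂Measure.pi (fun _ : Fin m => P) ≤
      ∫ S, radSup a (fun i t => 2 * x t (S i)) ∂Measure.pi (fun _ : Fin m => P) := by
  obtain ⟨A, hA⟩ := (Set.finite_range fun t => |a t|).bddAbove
  replace hA : ∀ t, |a t| ≤ A := fun t => hA ⟨t, rfl⟩
  have hED : ∀ t, |∫ z, x t z ∂P| ≤ D := fun t => abs_integral_le_of_abs_le (hD t)
  have h2D : ∀ t z, |2 * x t z| ≤ 2 * D := fun t z => by
    rw [abs_mul, abs_two]; linarith [hD t z]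
  induction m generalizing a A with
  | zero => simp [radSup_zero]
  | succ m ih =>
    set μ := Measure.pi (fun _ : Fin m => P)
    have hsupm : ∀ m' : ℕ, Measurable fun S : Fin m' → Z =>
        ⨆ t, (a t + ∑ i, (∫ z, x t z ∂P - x t (S i))) := fun m' =>
      Measurable.iSup fun t => by
        have := hx t
        fun_prop
    have hsupM : ∀ S : Fin (m + 1) → Z, |⨆ t, (a t + ∑ i, (∫ z, x t z ∂P - x t (S i)))|
        ≤ A + (m + 1 : ℕ) * (2 * D) := fun S => by
      have : ∀ t, |a t + ∑ i, (∫ z, x t z ∂P - x t (S i))| ≤ A + (m + 1 : ℕ) * (2 * D) := fun t => by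
        refine (abs_add_le _ _).trans (add_le_add (hA t) ?_)
        refine (Finset.abs_sum_le_sum_abs _ _).trans ?_
        refine (Finset.sum_le_card_nsmul _ _ (2 * D) fun i _ => ?_).trans (by simp)
        exact (abs_sub _ _).trans (by linarith [hED t, hD t (S i)])
      simpa [radSup_zero] using abs_radSup_le (m := 0) (b := Fin.elim0) (d := 0) this
        (fun i => i.elim0)
    have hA' : ∀ (z : Z) t, |a t + (∫ z', x t z' ∂P - x t z)| ≤ A + 2 * D := fun z t =>
      (abs_add_le _ _).trans (add_le_add (hA t) ((abs_sub _ _).trans (by linarith [hED t, hD t z])))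
    have hint : ∀ (b : ι → Z → ℝ) (B : ℝ), (∀ t, Measurable (b t)) → (∀ t z, |b t z| ≤ B) →
        Integrable (fun p : Z × (Fin m → Z) =>
          radSup (fun t => a t + b t p.1) (fun i t => 2 * x t (p.2 i))) (P.prod μ) :=
      fun b B hb hB => integrable_radSup (a := fun t (p : Z × (Fin m → Z)) => a t + b t p.1)
        (b := fun i t (p : Z × (Fin m → Z)) => 2 * x t (p.2 i)) (D := A + B) (d := 2 * D)
        (fun t => by have := hb t; fun_prop) (fun i t => by have := hx t; fun_prop)
        (fun t p => (abs_add_le _ _).trans (add_le_add (hA t) (hB t p.1))) (fun i t p => h2D _ _)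
    have hint1 := hint (fun t z => ∫ z', x t z' ∂P - x t z) (2 * D)
      (fun t => by have := hx t; fun_prop)
      (fun t z => (abs_sub _ _).trans (by linarith [hED t, hD t z]))
    have hintp := hint (fun t z => 2 * x t z) (2 * D) (fun t => by have := hx t; fun_prop) h2D
    have hintm := hint (fun t z => -(2 * x t z)) (2 * D) (fun t => by have := hx t; fun_prop)
      (fun t z => by rw [abs_neg]; exact h2D t z)
    rw [integral_pi_fin_succ P (hsupm _) hsupM]
    have hradm : Measurable fun S : Fin (m + 1) → Z => radSup a (fun i t => 2 * x t (S i)) :=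
      measurable_radSup (a := fun t _ => a t) (b := fun i t (S : Fin (m + 1) → Z) => 2 * x t (S i))
        (fun t => measurable_const) (fun i t => by have := hx t; fun_prop)
    rw [integral_pi_fin_succ P hradm fun S => abs_radSup_le hA fun i t => h2D t (S i)]
    calc ∫ z, ∫ S, ⨆ t, (a t + ∑ i, (∫ z, x t z ∂P - x t ((Fin.cons z S : Fin (m + 1) → Z) i)))
            ∂μ ∂P
        ≤ ∫ z, ∫ S, radSup (fun t => a t + (∫ z', x t z' ∂P - x t z))
            (fun i t => 2 * x t (S i)) ∂μ ∂P := by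
          refine integral_mono ?_ hint1.integral_prod_left fun z => ?_
          · have h := ((hsupm (m + 1)).comp measurable_fin_cons).stronglyMeasurable
            exact integrable_of_measurable_of_abs_le (StronglyMeasurable.integral_prod_right
              (f := fun z S => ⨆ t, (a t + ∑ i,
                (∫ z, x t z ∂P - x t ((Fin.cons z S : Fin (m + 1) → Z) i)))) h).measurable fun z => abs_integral_le_of_abs_le fun S => hsupM _
          · simp only [Fin.sum_univ_succ, Fin.cons_zero, Fin.cons_succ, ← add_assoc]
            simpa only [← add_assoc] using
              ih (fun t => a t + (∫ z', x t z' ∂P - x t z)) (A + 2 * D) (hA' z)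
      -- The order is exchanged so that the later observations are frozen while the first one is
      -- compared with a ghost copy.
      _ = ∫ S, ∫ z, radSup (fun t => a t + (∫ z', x t z' ∂P - x t z))
            (fun i t => 2 * x t (S i)) ∂P ∂μ := integral_integral_swap hint1
      _ ≤ ∫ S, ∫ z, (radSup (fun t => a t + 2 * x t z) (fun i t => 2 * x t (S i)) +
            radSup (fun t => a t + -(2 * x t z)) (fun i t => 2 * x t (S i))) / 2 ∂P ∂μ := by
          refine integral_mono hint1.integral_prod_right
            ((hintp.add hintm).div_const 2).integral_prod_right fun S => ?_
          have hi : ∀ (b : ι → Z → ℝ) (B : ℝ), (∀ t, Measurable (b t)) → (∀ t z, |b t z| ≤ B) →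
              Integrable (fun z => radSup (fun t => a t + b t z) (fun i t => 2 * x t (S i))) P :=
            fun b B hb hB => integrable_radSup (a := fun t z => a t + b t z)
              (b := fun i t _ => 2 * x t (S i)) (D := A + B) (d := 2 * D)
              (fun t => (hb t).const_add _) (fun i t => measurable_const)
              (fun t z => (abs_add_le _ _).trans (add_le_add (hA t) (hB t z)))
              (fun i t _ => h2D _ _)
          have hip := hi (fun t z => 2 * x t z) (2 * D) (fun t => by have := hx t; fun_prop) h2D
          have him := hi (fun t z => -(2 * x t z)) (2 * D) (fun t => by have := hx t; fun_prop)
            (fun t z => by rw [abs_neg]; exact h2D t z)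
          set c : Fin m → ι → ℝ := fun i t => 2 * x t (S i)
          -- The mean of `x t` is written as an average over a ghost observation `z'`. Jensen moves
          -- this average outside, and the midpoint inequality separates `z'` from `z`; as both have
          -- law `P`, the two halves become the two signs of one observation.
          have hpt : ∀ z, radSup (fun t => a t + (∫ z', x t z' ∂P - x t z)) c ≤
              (∫ z', radSup (fun t => a t + 2 * x t z') c ∂P
                + radSup (fun t => a t + -(2 * x t z)) c) / 2 := fun z => by
            have e : (fun t => a t + (∫ z', x t z' ∂P - x t z))
                = fun t => (a t - x t z) + ∫ z', x t z' ∂P := by funext t; ring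
            rw [e]
            refine (radSup_add_integral_le _ c hx hD).trans ?_
            have e2 : (∫ z', radSup (fun t => a t + 2 * x t z') c ∂P
                + radSup (fun t => a t + -(2 * x t z)) c) / 2
                = ∫ z', (radSup (fun t => a t + 2 * x t z') c
                + radSup (fun t => a t + -(2 * x t z)) c) / 2 ∂P := by
              rw [integral_div, integral_add hip (integrable_const _)]; simp
            rw [e2]
            refine integral_mono ?_ ((hip.add (integrable_const _)).div_const 2) fun z' => ?_
            · exact integrable_radSup (a := fun t z' => a t - x t z + x t z')
                (b := fun i t _ => c i t) (D := A + D + D) (d := 2 * D)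
                (fun t => (hx t).const_add _) (fun i t => measurable_const)
                (fun t z' => (abs_add_le _ _).trans (add_le_add ((abs_sub _ _).trans
                  (add_le_add (hA t) (hD t z))) (hD t z')))
                (fun i t _ => h2D _ _)
            · have h := radSup_midpoint_le a (fun t => x t z') (fun t => x t z) c
              have e3 : a + (fun t => x t z') - (fun t => x t z)
                  = fun t => a t - x t z + x t z' := by
                funext t; simp only [Pi.add_apply, Pi.sub_apply]; ring
              have e4 : a + (2 : ℝ) • (fun t => x t z') = fun t => a t + 2 * x t z' := by
                funext t; simp
              have e5 : a - (2 : ℝ) • (fun t => x t z) = fun t => a t + -(2 * x t z) := by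
                funext t; simp [sub_eq_add_neg]
              rwa [e3, e4, e5] at h
          have hi1 := hi (fun t z => ∫ z', x t z' ∂P - x t z) (2 * D)
            (fun t => by have := hx t; fun_prop)
            (fun t z => (abs_sub _ _).trans (by linarith [hED t, hD t z]))
          refine (integral_mono (g := fun z => (∫ z', radSup (fun t => a t + 2 * x t z') c ∂P
            + radSup (fun t => a t + -(2 * x t z)) c) / 2) hi1
            (((integrable_const _).add him).div_const 2) hpt).trans (le_of_eq ?_)
          simp only [integral_div]
          rw [integral_add (integrable_const _) him, integral_add hip him]
          simp
      _ = ∫ z, ∫ S, (radSup (fun t => a t + 2 * x t z) (fun i t => 2 * x t (S i)) +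
            radSup (fun t => a t + -(2 * x t z)) (fun i t => 2 * x t (S i))) / 2 ∂μ ∂P :=
          (integral_integral_swap ((hintp.add hintm).div_const 2)).symm
      _ = _ := by
          refine integral_congr_ae (Filter.Eventually.of_forall fun z => integral_congr_ae
            (Filter.Eventually.of_forall fun S => ?_))
          simp only [radSup_succ, Fin.cons_zero, Fin.cons_succ]
          simp only [← sub_eq_add_neg]
          rfl

end ProductMeasure

/-! ### A uniform margin bound for sums of ramp losses -/

/-- The ramp function, between the indicators of `t ≤ 0` and `t < 1`. -/
noncomputable def ramp (t : ℝ) : ℝ := max 0 (min 1 (1 - t))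

theorem ramp_nonneg (t : ℝ) : 0 ≤ ramp t := le_max_left _ _

theorem ramp_le_one (t : ℝ) : ramp t ≤ 1 := max_le zero_le_one (min_le_left _ _)

theorem ramp_of_nonpos {t : ℝ} (ht : t ≤ 0) : ramp t = 1 := by
  rw [ramp, min_eq_left (by linarith), max_eq_right zero_le_one]

theorem ramp_of_one_le {t : ℝ} (ht : 1 ≤ t) : ramp t = 0 :=
  max_eq_left ((min_le_right _ _).trans (by linarith))

theorem continuous_ramp : Continuous ramp := by unfold ramp; fun_prop

theorem abs_ramp_sub_ramp_le (s t : ℝ) : |ramp s - ramp t| ≤ |s - t| := by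
  have h1 := abs_max_sub_max_le_max 0 (min 1 (1 - s)) 0 (min 1 (1 - t))
  have h2 := abs_min_sub_min_le_max 1 (1 - s) 1 (1 - t)
  exact h1.trans (max_le (by simp) (h2.trans (max_le (by simp)
    (by rw [sub_sub_sub_cancel_left, abs_sub_comm]))))

section MarginBound

variable {Z H Q : Type*} [NormedAddCommGroup H] [InnerProductSpace ℝ H] [Fintype Q]

theorem sum_update_sub_sum {m : ℕ} (g : Z → ℝ) (S : Fin m → Z) (j : Fin m) (z : Z) :
    ∑ i, g (Function.update S j z i) - ∑ i, g (S i) = g z - g (S j) := by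
  rw [← Finset.sum_sub_distrib, Finset.sum_eq_single j]
  · simp
  · intro i _ hij
    simp [Function.update_of_ne hij]
  · simp

/-- The ramp losses of the linear functionals `w q`, with weights `u q`, summed and capped at `1`. -/
noncomputable def cappedLoss (u : Q → Z → ℝ) (v : Q → Z → H) (w : Q → H) (z : Z) : ℝ :=
  min 1 (∑ q, u q z * ramp (inner ℝ (w q) (v q z)))

theorem cappedLoss_nonneg {u : Q → Z → ℝ} (hu : ∀ q z, 0 ≤ u q z) (v : Q → Z → H) (w : Q → H)
    (z : Z) : 0 ≤ cappedLoss u v w z :=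
  le_min zero_le_one (Finset.sum_nonneg fun q _ => mul_nonneg (hu q z) (ramp_nonneg _))

theorem cappedLoss_le_one (u : Q → Z → ℝ) (v : Q → Z → H) (w : Q → H) (z : Z) :
    cappedLoss u v w z ≤ 1 := min_le_left _ _

theorem continuous_cappedLoss (u : Q → Z → ℝ) (v : Q → Z → H) (z : Z) :
    Continuous fun w : Q → H => cappedLoss u v w z := by
  have := continuous_ramp
  unfold cappedLoss
  fun_prop

/-- Capping at `1` is a contraction, so the cap is dropped first; then the sub-problems are
separated and the `1`-Lipschitz ramp is removed in each. The weights pass into the vectors, so only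
points with nonzero weight contribute to a root. -/
theorem radSup_cappedLoss_le {ι : Type*} [Finite ι] [Nonempty ι] {m : ℕ} {u : Q → Z → ℝ}
    {v : Q → Z → H} {R : ℝ} (hu : ∀ q z, 0 ≤ u q z) (hv : ∀ q z, ‖v q z‖ ≤ R) {w : ι → Q → H}
    (hw : ∀ t q, ‖w t q‖ ≤ 1) (S : Fin m → Z) :
    radSup 0 (fun i t => 2 * cappedLoss u v (w t) (S i)) ≤
      2 * R * ∑ q, √(∑ i, u q (S i) ^ 2) := by
  have h1 : radSup (0 : ι → ℝ) (fun i t => 2 * cappedLoss u v (w t) (S i)) ≤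
      radSup 0 (fun i t => ∑ q, 2 * (u q (S i) * ramp (inner ℝ (w t q) (v q (S i))))) := by
    refine radSup_contraction _ fun i s t => ?_
    rw [← Finset.mul_sum, ← Finset.mul_sum, ← mul_sub, ← mul_sub, abs_mul, abs_mul]
    refine mul_le_mul_of_nonneg_left ?_ (abs_nonneg _)
    refine (abs_min_sub_min_le_max _ _ _ _).trans ?_
    rw [sub_self, abs_zero, max_eq_right (abs_nonneg _)]
  have h2 := radSup_sum_le (m := m) (fun (_ : Q) (_ : ι) => (0 : ℝ))
    (fun q i t => 2 * (u q (S i) * ramp (inner ℝ (w t q) (v q (S i)))))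
  rw [show (fun _ : ι => ∑ _ : Q, (0 : ℝ)) = 0 by funext; simp] at h2
  refine (h1.trans h2).trans ?_
  rw [Finset.mul_sum]
  refine Finset.sum_le_sum fun q _ => ?_
  have h3 : radSup (fun _ : ι => (0 : ℝ))
        (fun i t => 2 * (u q (S i) * ramp (inner ℝ (w t q) (v q (S i))))) ≤
      radSup (fun t => inner ℝ (w t q) 0)
        (fun i t => inner ℝ (w t q) ((2 * u q (S i)) • v q (S i))) := by
    simp only [inner_zero_right]
    refine radSup_contraction _ fun i s t => ?_
    simp only [inner_smul_right]
    rw [← mul_assoc, ← mul_assoc, ← mul_sub, ← mul_sub, abs_mul (2 * u q (S i)),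
      abs_mul (2 * u q (S i))]
    exact mul_le_mul_of_nonneg_left (abs_ramp_sub_ramp_le _ _) (abs_nonneg _)
  refine (h3.trans (radSup_inner_le (fun t => hw t q) 0 _)).trans ?_
  have hle : ∑ i, ‖(2 * u q (S i)) • v q (S i)‖ ^ 2 ≤ (2 * R) ^ 2 * ∑ i, u q (S i) ^ 2 := by
    rw [Finset.mul_sum]
    refine Finset.sum_le_sum fun i _ => ?_
    rw [norm_smul, Real.norm_eq_abs, abs_of_nonneg (mul_nonneg zero_le_two (hu q (S i))), mul_pow,
      mul_pow, mul_pow]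
    have : ‖v q (S i)‖ ^ 2 ≤ R ^ 2 := by gcongr; exact hv q (S i)
    nlinarith [sq_nonneg (u q (S i))]
  -- The sign of `R` is known only once there is a sample point at which to evaluate `v q`.
  rcases isEmpty_or_nonempty (Fin m) with hm | ⟨⟨i⟩⟩
  · simp
  have hR : 0 ≤ R := (norm_nonneg _).trans (hv q (S i))
  refine (Real.sqrt_le_sqrt (by simpa using hle)).trans_eq ?_
  rw [Real.sqrt_mul (sq_nonneg _), Real.sqrt_sq (by positivity)]

variable [MeasurableSpace Z] {P : Measure Z} [IsProbabilityMeasure P]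

/-- Uniform deviation of the empirical means of finitely many `[0, 1]`-valued functions. -/
theorem measure_iSup_sub_radSup_ge_le {ι : Type*} [Finite ι] [Nonempty ι] {m : ℕ} (hm : 0 < m)
    {x : ι → Z → ℝ} (hx : ∀ t, Measurable (x t)) (hx0 : ∀ t z, 0 ≤ x t z) (hx1 : ∀ t z, x t z ≤ 1)
    {r : ℝ} (hr : 0 ≤ r) :
    (Measure.pi (fun _ : Fin m => P)).real
      {S | r ≤ (⨆ t, ∑ i, (∫ z, x t z ∂P - x t (S i))) - radSup 0 (fun i t => 2 * x t (S i))} ≤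
      Real.exp (-2 * r ^ 2 / (m * 3 ^ 2)) := by
  have habs : ∀ t z, |x t z| ≤ 1 := fun t z => abs_le.2 ⟨by linarith [hx0 t z], hx1 t z⟩
  have habs2 : ∀ t z, |2 * x t z| ≤ 2 := fun t z =>
    abs_le.2 ⟨by linarith [hx0 t z], by linarith [hx1 t z]⟩
  have hE : ∀ t, |∫ z, x t z ∂P| ≤ 1 := fun t => abs_integral_le_of_abs_le (habs t)
  -- A supremum is a Rademacher average with no signs, so the same perturbation bounds apply to it.
  have hsup : ∀ a : ι → ℝ, (⨆ t, a t) = radSup a (Fin.elim0 : Fin 0 → ι → ℝ) := fun _ => rfl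
  have hsm : Measurable fun S : Fin m → Z => ⨆ t, ∑ i, (∫ z, x t z ∂P - x t (S i)) :=
    Measurable.iSup fun t => by have := hx t; fun_prop
  have hrm : Measurable fun S : Fin m → Z =>
      radSup (0 : ι → ℝ) (fun i t => 2 * x t (S i)) :=
    measurable_radSup (a := fun _ _ => 0) (b := fun i t (S : Fin m → Z) => 2 * x t (S i))
      (fun t => measurable_const) (fun i t => by have := hx t; fun_prop)
  have hsM : ∀ S : Fin m → Z, |⨆ t, ∑ i, (∫ z, x t z ∂P - x t (S i))| ≤ m * 2 := fun S => by
    rw [hsup]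
    refine (abs_radSup_le (D := m * 2) (d := 0) (fun t => ?_) fun i => i.elim0).trans (by simp)
    refine (Finset.abs_sum_le_sum_abs _ _).trans ?_
    refine (Finset.sum_le_card_nsmul _ _ 2 fun i _ => ?_).trans (by simp)
    exact (abs_sub _ _).trans (by linarith [hE t, habs t (S i)])
  have hrM : ∀ S : Fin m → Z, |radSup (0 : ι → ℝ) (fun i t => 2 * x t (S i))| ≤ 0 + m * 2 :=
    fun S => abs_radSup_le (by simp) fun i t => habs2 t (S i)
  -- Changing one observation moves the supremum by at most `1` and the Rademacher average by at
  -- most `2`, hence increments of `3`. Subtracting the empirical average inside the event lets one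
  -- application of McDiarmid suffice.
  refine measure_ge_le_of_bounded_differences hm (hsm.sub hrm) (M := m * 2 + (0 + m * 2))
    (fun S => (abs_sub _ _).trans (add_le_add (hsM S) (hrM S))) (by norm_num) ?_ ?_ hr
  · intro S j z
    have key : ∀ S₁ S₂ : Fin m → Z, (∀ t, |∑ i, x t (S₁ i) - ∑ i, x t (S₂ i)| ≤ 1) →
        (∀ i, i ≠ j → S₁ i = S₂ i) →
        (⨆ t, ∑ i, (∫ z, x t z ∂P - x t (S₁ i))) ≤
          (⨆ t, ∑ i, (∫ z, x t z ∂P - x t (S₂ i))) + 1 ∧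
        radSup (0 : ι → ℝ) (fun i t => 2 * x t (S₁ i)) ≤
          radSup (0 : ι → ℝ) (fun i t => 2 * x t (S₂ i)) + 2 := by
      intro S₁ S₂ h1 h2
      constructor
      · rw [hsup, hsup]
        have h3 := radSup_le_radSup_add (D := 1) (d := fun _ => 0) (b := Fin.elim0) (b' := Fin.elim0)
          (a := fun t => ∑ i, (∫ z, x t z ∂P - x t (S₁ i)))
          (a' := fun t => ∑ i, (∫ z, x t z ∂P - x t (S₂ i))) (fun t => ?_) fun i => i.elim0
        · simpa using h3
        have := (abs_le.1 (h1 t)).1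
        simp only [Finset.sum_sub_distrib]
        linarith
      · have h3 := radSup_le_radSup_add (D := 0) (d := fun i => if i = j then 2 else 0)
          (a := (0 : ι → ℝ)) (a' := 0) (b := fun i t => 2 * x t (S₁ i))
          (b' := fun i t => 2 * x t (S₂ i)) (fun t => by simp) fun i t => ?_
        · simpa using h3
        by_cases hij : i = j
        · rw [if_pos hij, abs_le]
          constructor <;> linarith [hx0 t (S₁ i), hx1 t (S₁ i), hx0 t (S₂ i), hx1 t (S₂ i)]
        · rw [if_neg hij, h2 i hij, sub_self, abs_zero]
    have hd : ∀ t, |∑ i, x t (Function.update S j z i) - ∑ i, x t (S i)| ≤ 1 := fun t => by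
      rw [sum_update_sub_sum, abs_le]
      constructor <;> linarith [hx0 t z, hx1 t z, hx0 t (S j), hx1 t (S j)]
    obtain ⟨a1, a2⟩ := key (Function.update S j z) S hd fun i hi => Function.update_of_ne hi _ _
    obtain ⟨b1, b2⟩ := key S (Function.update S j z) (fun t => by rw [abs_sub_comm]; exact hd t)
      fun i hi => (Function.update_of_ne hi _ _).symm
    simp only [Pi.sub_apply]
    rw [abs_le]
    constructor <;> linarith
  · have hs := integrable_of_measurable_of_abs_le (μ := Measure.pi fun _ : Fin m => P) hsm hsM
    have hr := integrable_of_measurable_of_abs_le (μ := Measure.pi fun _ : Fin m => P) hrm hrM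
    have h := integral_iSup_le_integral_radSup (P := P) (m := m) (0 : ι → ℝ) hx habs
    simp only [Pi.zero_apply, zero_add] at h
    simp only [Pi.sub_apply]
    rw [integral_sub hs hr]
    linarith

theorem measurable_cappedLoss {u : Q → Z → ℝ} {v : Q → Z → H} (hu : ∀ q, Measurable (u q))
    (hv : ∀ q (h : H), Measurable fun z => (inner ℝ h (v q z) : ℝ)) (w : Q → H) :
    Measurable (cappedLoss u v w) :=
  measurable_const.min (Finset.measurable_fun_sum _ fun q _ =>
    (hu q).mul (continuous_ramp.measurable.comp (hv q (w q))))

/-- A uniform margin bound for all families of linear functionals of norm at most `1`. -/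
theorem exists_uniform_margin_event [SecondCountableTopology H] {m : ℕ} (hm : 0 < m)
    {u : Q → Z → ℝ} {v : Q → Z → H} {R : ℝ} (hu : ∀ q z, 0 ≤ u q z) (hum : ∀ q, Measurable (u q))
    (hv : ∀ q z, ‖v q z‖ ≤ R) (hvm : ∀ q (h : H), Measurable fun z => (inner ℝ h (v q z) : ℝ))
    {δ : ℝ} (hδ0 : 0 < δ) (hδ1 : δ < 1) :
    ∃ G : Set (Fin m → Z), MeasurableSet G ∧
      ENNReal.ofReal (1 - δ) ≤ Measure.pi (fun _ : Fin m => P) G ∧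
      ∀ S ∈ G, ∀ w : Q → H, (∀ q, ‖w q‖ ≤ 1) →
        m * ∫ z, cappedLoss u v w z ∂P ≤ ∑ i, cappedLoss u v w (S i) +
          (2 * R * ∑ q, √(∑ i, u q (S i) ^ 2) + 3 * √(m * Real.log (1 / δ) / 2)) := by
  set μ := Measure.pi (fun _ : Fin m => P) with hμ
  -- Chosen so that the tail `exp (-2 r ^ 2 / (9 m))` equals `δ`.
  set r := 3 * √(m * Real.log (1 / δ) / 2) with hr
  have hlog : 0 ≤ Real.log (1 / δ) := Real.log_nonneg (by rw [le_div_iff₀ hδ0]; linarith)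
  let W := {w : Q → H // ∀ q, ‖w q‖ ≤ 1}
  have : Nonempty W := ⟨⟨0, by simp⟩⟩
  let D : ℕ → W := TopologicalSpace.denseSeq W
  let bad : ℕ → Set (Fin m → Z) := fun n => {S |
    ∑ i, cappedLoss u v (D n).1 (S i) + (2 * R * ∑ q, √(∑ i, u q (S i) ^ 2) + r) <
      m * ∫ z, cappedLoss u v (D n).1 z ∂P}
  have hbadm : ∀ n, MeasurableSet (bad n) := fun n => by
    have := measurable_cappedLoss hum hvm (D n).1
    exact measurableSet_lt (by fun_prop) measurable_const
  -- The estimate does not depend on how many members of the dense sequence are used, so it survives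
  -- the increasing union below.
  have hfin : ∀ N, μ (⋃ n ≤ N, bad n) ≤ ENNReal.ofReal δ := fun N => by
    have h := measure_iSup_sub_radSup_ge_le (P := P) hm (ι := Fin (N + 1))
      (x := fun t => cappedLoss u v (D t).1) (fun t => measurable_cappedLoss hum hvm _)
      (fun t => cappedLoss_nonneg hu v _) (fun t => cappedLoss_le_one u v _) (r := r)
      (by positivity)
    have he : Real.exp (-2 * r ^ 2 / (m * 3 ^ 2)) = δ := by
      have hm' : (m : ℝ) ≠ 0 := by exact_mod_cast hm.ne'
      rw [hr, mul_pow, Real.sq_sqrt (by positivity)]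
      rw [show -2 * (3 ^ 2 * (m * Real.log (1 / δ) / 2)) / (m * 3 ^ 2) = -Real.log (1 / δ) by
        field_simp]
      rw [one_div, Real.log_inv, neg_neg, Real.exp_log hδ0]
    rw [he] at h
    have h := ENNReal.ofReal_le_ofReal h
    rw [ofReal_measureReal] at h
    refine (measure_mono ?_).trans h
    · intro S hS
      simp only [Set.mem_iUnion] at hS
      obtain ⟨n, hn, hS⟩ := hS
      simp only [bad, Set.mem_ofPred_eq] at hS
      have h1 := radSup_cappedLoss_le (ι := Fin (N + 1)) hu hv (fun t => (D t).2) S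
      have h2 := le_ciSup (f := fun t : Fin (N + 1) =>
        ∑ i, (∫ z, cappedLoss u v (D t).1 z ∂P - cappedLoss u v (D t).1 (S i)))
        (Set.finite_range _).bddAbove ⟨n, by omega⟩
      simp only [Finset.sum_sub_distrib, Finset.sum_const, Finset.card_univ, Fintype.card_fin,
        nsmul_eq_mul] at h2
      simp only [Set.mem_ofPred_eq, Finset.sum_sub_distrib, Finset.sum_const, Finset.card_univ,
        Fintype.card_fin, nsmul_eq_mul]
      linarith
  have hbad : μ (⋃ n, bad n) ≤ ENNReal.ofReal δ := by
    rw [← Set.iUnion_accumulate, Set.monotone_accumulate.measure_iUnion]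
    exact iSup_le hfin
  have hbm : MeasurableSet (⋃ n, bad n) := MeasurableSet.iUnion hbadm
  refine ⟨(⋃ n, bad n)ᶜ, hbm.compl, ?_, fun S hS w hw => ?_⟩
  · rw [prob_compl_eq_one_sub hbm, ENNReal.ofReal_sub _ hδ0.le, ENNReal.ofReal_one]
    exact tsub_le_tsub_left hbad 1
  -- Both sides are continuous in `w`, the integral by dominated convergence, so the inequality
  -- extends from the dense sequence to the whole unit ball.
  · have hclosed : IsClosed {w : W | m * ∫ z, cappedLoss u v w.1 z ∂P ≤
        ∑ i, cappedLoss u v w.1 (S i) + (2 * R * ∑ q, √(∑ i, u q (S i) ^ 2) + r)} := by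
      have hc := fun z => (continuous_cappedLoss u v z).comp (continuous_subtype_val :
        Continuous (Subtype.val : W → Q → H))
      refine isClosed_le (continuous_const.mul ?_)
        ((continuous_finsetSum _ fun i _ => hc (S i)).add continuous_const)
      refine continuous_of_dominated (bound := fun _ => 1)
        (fun w => (measurable_cappedLoss hum hvm w.1).aestronglyMeasurable)
        (fun w => Filter.Eventually.of_forall fun z => ?_) (integrable_const _)
        (Filter.Eventually.of_forall hc)
      rw [Real.norm_eq_abs, abs_of_nonneg (cappedLoss_nonneg hu v _ z)]
      exact cappedLoss_le_one u v _ z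
    refine (TopologicalSpace.denseRange_denseSeq W).induction_on (p := fun w : W =>
      m * ∫ z, cappedLoss u v w.1 z ∂P ≤
        ∑ i, cappedLoss u v w.1 (S i) + (2 * R * ∑ q, √(∑ i, u q (S i) ^ 2) + r))
      ⟨w, hw⟩ hclosed fun n => ?_
    by_contra hn
    exact hS (Set.mem_iUnion.2 ⟨n, not_le.1 hn⟩)

end MarginBound

/-! ### Continuity of the landmark feature map and separability of its Hilbert space -/

theorem pointDist_comm (x y : DiagramPoint) : pointDist x y = pointDist y x := by
  rcases x with _ | x <;> rcases y with _ | y <;> simp only [pointDist]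
  rw [dist_comm, max_comm]

theorem halfPersistence_le_add_dist (x y : ℝ × ℝ) :
    (x.2 - x.1) / 2 ≤ (y.2 - y.1) / 2 + dist x y := by
  have h1 : |x.1 - y.1| ≤ dist x y := le_max_left _ _
  have h2 : |x.2 - y.2| ≤ dist x y := le_max_right _ _
  have := abs_le.1 h1
  have := abs_le.1 h2
  linarith

/-- Half the persistence is the distance to the diagonal and is `1`-Lipschitz for `ℓ^∞`. If both
legs are direct, the ordinary triangle inequality applies; if a leg uses the diagonal, so can the
whole path. -/
theorem pointDist_triangle (x y z : DiagramPoint) :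
    pointDist x z ≤ pointDist x y + pointDist y z := by
  rcases x with _ | x <;> rcases y with _ | y <;> rcases z with _ | z <;> simp only [pointDist]
  · simp
  · simp
  · have := y.2
    linarith
  · have := halfPersistence_le_add_dist z.1 y.1
    rw [dist_comm] at this
    have := le_max_right ((y.1.2 - y.1.1) / 2) ((z.1.2 - z.1.1) / 2)
    have := y.2
    rcases min_choice (dist y.1 z.1) (max ((y.1.2 - y.1.1) / 2) ((z.1.2 - z.1.1) / 2)) with h | h <;>
      rw [h] <;> linarith
  · simp
  · have := x.2
    have := z.2
    exact (min_le_right _ _).trans (max_le (by linarith) (by linarith))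
  · have := halfPersistence_le_add_dist x.1 y.1
    have := le_max_left ((x.1.2 - x.1.1) / 2) ((y.1.2 - y.1.1) / 2)
    have := y.2
    rcases min_choice (dist x.1 y.1) (max ((x.1.2 - x.1.1) / 2) ((y.1.2 - y.1.1) / 2)) with h | h <;>
      rw [h] <;> linarith
  · have h1 := halfPersistence_le_add_dist x.1 y.1
    have h2 := halfPersistence_le_add_dist z.1 y.1
    rw [dist_comm] at h2
    have h3 := dist_triangle x.1 y.1 z.1
    have h4 := le_max_left ((x.1.2 - x.1.1) / 2) ((y.1.2 - y.1.1) / 2)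
    have h5 := le_max_right ((x.1.2 - x.1.1) / 2) ((y.1.2 - y.1.1) / 2)
    have h6 := le_max_left ((y.1.2 - y.1.1) / 2) ((z.1.2 - z.1.1) / 2)
    have h7 := le_max_right ((y.1.2 - y.1.1) / 2) ((z.1.2 - z.1.1) / 2)
    have := x.2
    have := y.2
    have := z.2
    have := dist_nonneg (x := x.1) (y := y.1)
    have := dist_nonneg (x := y.1) (y := z.1)
    rcases min_choice (dist x.1 y.1) (max ((x.1.2 - x.1.1) / 2) ((y.1.2 - y.1.1) / 2)) with h | h <;>
      rcases min_choice (dist y.1 z.1) (max ((y.1.2 - y.1.1) / 2) ((z.1.2 - z.1.1) / 2)) with h' | h' <;>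
      rw [h, h']
    · exact (min_le_left _ _).trans h3
    all_goals exact (min_le_right _ _).trans (max_le (by linarith) (by linarith))

theorem abs_coordFun_sub_coordFun_le (p : DiagramPoint) (r : ℝ) (x y : DiagramPoint) :
    |coordFun p r x - coordFun p r y| ≤ pointDist x y := by
  refine (abs_max_sub_max_le_abs _ _ _).trans ?_
  have h1 := pointDist_triangle p x y
  have h2 := pointDist_triangle p y x
  rw [pointDist_comm y x] at h2
  rw [abs_le]
  constructor <;> linarith

theorem abs_sum_map_sub_sum_map_le {α : Type*} {d : α → α → ℝ} {g : α → ℝ}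
    (hg : ∀ x y, |g x - g y| ≤ d x y) {r : ℝ} {s t : Multiset α}
    (h : Multiset.Rel (fun x y => d x y ≤ r) s t) :
    |(s.map g).sum - (t.map g).sum| ≤ s.card * r := by
  induction h with
  | zero => simp
  | @cons a b s t hab _ ih =>
    simp only [Multiset.map_cons, Multiset.sum_cons, Multiset.card_cons, Nat.cast_add, Nat.cast_one]
    have := (hg a b).trans hab
    rw [add_sub_add_comm]
    exact (abs_add_le _ _).trans (by linarith)

theorem exists_rel_of_bottleneckDist_lt {n : ℕ} {A B : Diagram n} {η : ℝ}
    (h : bottleneckDist A B < η) :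
    ∃ r < η, 0 ≤ r ∧ Multiset.Rel (fun x y => pointDist x y ≤ r) A.1 B.1 := by
  -- Any matching of two multisets of equal size has a finite cost. Nonemptiness matters because the
  -- infimum of the empty set would be the default `0`.
  have hne : {r : ℝ | 0 ≤ r ∧ Multiset.Rel (fun x y => pointDist x y ≤ r) A.1 B.1}.Nonempty := by
    obtain ⟨M, hM⟩ := ((Multiset.finite_toSet (A.1 ×ˢ B.1)).image
      fun p : DiagramPoint × DiagramPoint => pointDist p.1 p.2).bddAbove
    refine ⟨max M 0, le_max_right _ _, Multiset.rel_of_forall (fun x y hx hy => ?_) ?_⟩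
    · exact (hM ⟨(x, y), Multiset.mem_product.2 ⟨hx, hy⟩, rfl⟩).trans (le_max_left _ _)
    · rw [A.2, B.2]
  obtain ⟨r, hr, hlt⟩ := exists_lt_of_csInf_lt hne h
  exact ⟨r, hlt, hr.1, hr.2⟩

theorem continuous_of_bottleneckDist {n : ℕ} {Y : Type*} [PseudoMetricSpace Y] {f : Diagram n → Y}
    (hf : ∀ A, ∀ ε > 0, ∃ η > 0, ∀ B, bottleneckDist A B < η → dist (f B) (f A) < ε) :
    Continuous f := by
  refine continuous_def.2 fun U hU A hA => ?_
  obtain ⟨ε, hε, h⟩ := Metric.isOpen_iff.1 hU (f A) hA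
  obtain ⟨η, hη, h'⟩ := hf A ε hε
  exact ⟨η, hη, fun B hB => h (h' B hB)⟩

theorem continuous_sumEmbed {K n : ℕ} (L : LandmarkConfig K) :
    Continuous fun A : Diagram n => sumEmbed L A := by
  refine continuous_pi fun j => continuous_of_bottleneckDist fun A ε hε => ?_
  have hw := L.weight_pos j
  -- A matching of cost `r` moves the sum by at most `n * r`; `n + 1` keeps the denominator positive
  -- for empty diagrams.
  have hpos : 0 < L.weight j * (n + 1) := by positivity
  refine ⟨ε / (L.weight j * (n + 1)), by positivity, fun B hB => ?_⟩
  obtain ⟨r, hr, hr0, hrel⟩ := exists_rel_of_bottleneckDist_lt hB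
  have h := abs_sum_map_sub_sum_map_le
    (abs_coordFun_sub_coordFun_le (L.pos j) (L.radius j)) hrel
  rw [A.2] at h
  rw [lt_div_iff₀ hpos] at hr
  rw [dist_comm, Real.dist_eq, sumEmbed, sumEmbed, ← mul_sub, abs_mul, abs_of_pos hw]
  refine lt_of_le_of_lt (mul_le_mul_of_nonneg_left h hw.le) ?_
  nlinarith [mul_nonneg hw.le hr0]

instance instBorelSpaceDiagram (n : ℕ) : BorelSpace (Diagram n) := ⟨rfl⟩

theorem norm_featureMap {K n : ℕ} (L : LandmarkConfig K) (σ : ℝ) (A : Diagram n) :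
    ‖featureMap L σ A‖ = √(K : ℝ) := by
  rw [norm_eq_sqrt_real_inner, inner_featureMap]
  simp [landmarkKernel]

theorem norm_featureMap_sub_featureMap {K n : ℕ} (L : LandmarkConfig K) (σ : ℝ) (A B : Diagram n) :
    ‖featureMap L σ A - featureMap L σ B‖ = √(2 * ∑ j,
      (1 - Real.exp (-(sumEmbed L A j - sumEmbed L B j) ^ 2 / (2 * σ ^ 2)))) := by
  rw [eq_comm, ← Real.sqrt_sq (norm_nonneg _)]
  congr 1
  rw [norm_sub_sq_real, inner_featureMap, norm_featureMap, norm_featureMap,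
    Real.sq_sqrt (Nat.cast_nonneg _), landmarkKernel, Finset.sum_sub_distrib]
  simp only [Finset.sum_const, Finset.card_univ, Fintype.card_fin, nsmul_eq_mul, mul_one]
  ring

/-- The feature map is as continuous as the summation embedding. -/
theorem continuous_featureMap_comp {K n : ℕ} (L : LandmarkConfig K) (σ : ℝ) {T : Type*}
    [TopologicalSpace T] {g : T → Diagram n} (hg : Continuous fun x => sumEmbed L (g x)) :
    Continuous fun x => featureMap L σ (g x) := by
  refine continuous_iff_continuousAt.2 fun x => tendsto_iff_norm_sub_tendsto_zero.2 ?_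
  simp only [norm_featureMap_sub_featureMap]
  have hj := fun j => (continuous_pi_iff.1 hg) j
  have hc : Continuous fun y => √(2 * ∑ j,
      (1 - Real.exp (-(sumEmbed L (g y) j - sumEmbed L (g x) j) ^ 2 / (2 * σ ^ 2)))) := by
    fun_prop
  have := hc.tendsto x
  simpa using this

theorem continuous_featureMap {K n : ℕ} (L : LandmarkConfig K) (σ : ℝ) :
    Continuous fun A : Diagram n => featureMap L σ A :=
  continuous_featureMap_comp L σ (g := fun A => A) (continuous_sumEmbed L)

/-- Features depend on a diagram only through its embedding in `Fin K → ℝ`. Composed with a section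
of the embedding, the feature map is continuous on a separable set and has the same range, so
separability of the diagram space is not needed. -/
theorem isSeparable_range_featureMap {K : ℕ} (n : ℕ) (L : LandmarkConfig K) (σ : ℝ) :
    TopologicalSpace.IsSeparable (Set.range fun A : Diagram n => featureMap L σ A) := by
  choose g hg using fun x : Set.range (fun A : Diagram n => sumEmbed L A) => x.2
  have hc : Continuous fun x => featureMap L σ (g x) :=
    continuous_featureMap_comp L σ (by simpa only [hg] using continuous_subtype_val)
  refine (TopologicalSpace.isSeparable_range hc).mono ?_
  rintro _ ⟨A, rfl⟩
  have hA : sumEmbed L (g ⟨_, Set.mem_range_self A⟩) = sumEmbed L A := hg _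
  refine ⟨⟨_, Set.mem_range_self A⟩, ?_⟩
  rw [← sub_eq_zero, ← norm_eq_zero, norm_featureMap_sub_featureMap, hA]
  simp

/-- The span of the features is dense, and their range is separable. This provides the dense
sequence for the uniform bound. -/
instance instSecondCountableTopologyLandmarkRKHS {K : ℕ} (n : ℕ) (L : LandmarkConfig K) (σ : ℝ) :
    SecondCountableTopology (LandmarkRKHS n L σ) := by
  have h := (isSeparable_range_featureMap n L σ).span (R := ℝ).closure
  have hd := RKHS.kerFun_dense (LandmarkRKHS n L σ)
  have huniv : TopologicalSpace.IsSeparable (Set.univ : Set (LandmarkRKHS n L σ)) := by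
    refine h.mono fun x _ => ?_
    have hx : x ∈ (Submodule.span ℝ
        {RKHS.kerFun (LandmarkRKHS n L σ) A v | (A) (v)}).topologicalClosure := by
      rw [hd]; trivial
    refine closure_mono (Submodule.span_le.2 ?_) hx
    rintro _ ⟨A, v, rfl⟩
    have e : RKHS.kerFun (LandmarkRKHS n L σ) A v = v • featureMap L σ A := by
      rw [featureMap, ← map_smul, smul_eq_mul, mul_one]
    rw [e]
    exact Submodule.smul_mem _ _ (Submodule.subset_span ⟨A, rfl⟩)
  have := TopologicalSpace.isSeparable_univ_iff.1 huniv
  exact UniformSpace.secondCountable_of_separable _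

/-! ### One-vs-one voting -/

/-- The increasing pair formed by two distinct classes. -/
def ClassPair.mk {k : ℕ} (a b : Fin k) (h : a ≠ b) : ClassPair k :=
  if hab : a < b then ⟨(a, b), hab⟩ else ⟨(b, a), lt_of_le_of_ne (not_lt.1 hab) h.symm⟩

/-- `c` is one of the two classes of the pair `q`. -/
def ClassPair.Involves {k : ℕ} (q : ClassPair k) (c : Fin k) : Prop := c = q.1.1 ∨ c = q.1.2

instance ClassPair.decidableInvolves {k : ℕ} (q : ClassPair k) (c : Fin k) :
    Decidable (q.Involves c) := inferInstanceAs (Decidable (_ ∨ _))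

theorem ClassPair.mk_involves_left {k : ℕ} {a b : Fin k} (h : a ≠ b) :
    (ClassPair.mk a b h).Involves a := by
  unfold ClassPair.mk Involves; split <;> simp

theorem ClassPair.mk_involves_right {k : ℕ} {a b : Fin k} (h : a ≠ b) :
    (ClassPair.mk a b h).Involves b := by
  unfold ClassPair.mk Involves; split <;> simp

theorem ClassPair.eq_mk {k : ℕ} {q : ClassPair k} {a b : Fin k} (h : a ≠ b)
    (ha : q.Involves a) (hb : q.Involves b) : q = ClassPair.mk a b h := by
  obtain ⟨⟨x, y⟩, hxy⟩ := q
  simp only [Involves] at ha hb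
  have hxy : x < y := hxy
  unfold ClassPair.mk
  rcases ha with rfl | rfl <;> rcases hb with rfl | rfl
  · exact absurd rfl h
  · rw [dif_pos hxy]
  · rw [dif_neg hxy.not_gt]
  · exact absurd rfl h

/-- Each other class forms exactly one pair with `c`. The count serves both as the score of an
unbeaten class and as the multiplicity of a training point. -/
theorem card_filter_involves {k : ℕ} (c : Fin k) :
    (Finset.univ.filter fun q : ClassPair k => q.Involves c).card = k - 1 := by
  have h : (Finset.univ.erase c).card = k - 1 := by simp
  rw [← h, eq_comm]
  refine Finset.card_bij (fun a ha => ClassPair.mk c a (Finset.ne_of_mem_erase ha).symm) ?_ ?_ ?_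
  · intro a ha
    simpa using ClassPair.mk_involves_left _
  · intro a ha b hb hab
    have ha' := (Finset.ne_of_mem_erase ha).symm
    have hb' := (Finset.ne_of_mem_erase hb).symm
    have h1 := ClassPair.mk_involves_right ha'
    have h2 := ClassPair.mk_involves_right hb'
    rw [← hab] at h2
    have h3 := ClassPair.mk_involves_left ha'
    simp only [ClassPair.Involves] at h1 h2 h3
    have := (ClassPair.mk c a ha').2
    grind
  · intro q hq
    have hq := (Finset.mem_filter.1 hq).2
    rcases hq with hq | hq
    · have hne : c ≠ q.1.2 := hq ▸ q.2.ne
      exact ⟨q.1.2, by simp [hne.symm], (ClassPair.eq_mk hne (Or.inl hq) (Or.inr rfl)).symm⟩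
    · have hne : c ≠ q.1.1 := hq ▸ q.2.ne'
      exact ⟨q.1.1, by simp [hne.symm], (ClassPair.eq_mk hne (Or.inr hq) (Or.inl rfl)).symm⟩

theorem pairPredict_involves {K n k : ℕ} (L : LandmarkConfig K) (σ : ℝ)
    (w : ClassPair k → LandmarkRKHS n L σ) (q : ClassPair k) (A : Diagram n) :
    q.Involves (pairPredict L σ w q A) := by
  unfold pairPredict ClassPair.Involves; split <;> simp

theorem pairPredict_eq_of_signedMargin_pos {K n k : ℕ} {L : LandmarkConfig K} {σ : ℝ}
    {w : ClassPair k → LandmarkRKHS n L σ} {q : ClassPair k} {z : Diagram n × Fin k}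
    (hq : q.Involves z.2) (h : 0 < signedMargin L σ q (w q) z) :
    pairPredict L σ w q z.1 = z.2 := by
  unfold pairPredict
  unfold signedMargin at h
  rcases hq with hq | hq
  · rw [if_pos hq, one_mul] at h
    rw [if_pos h, hq]
  · rw [if_neg (hq ▸ q.2.ne'), neg_one_mul] at h
    rw [if_neg (by linarith), hq]

/-- A majority vote errs only if some binary classifier of the true class errs. -/
theorem exists_signedMargin_nonpos {K n k : ℕ} {L : LandmarkConfig K} {σ : ℝ}
    {w : ClassPair k → LandmarkRKHS n L σ} {f : Diagram n → Fin k}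
    (hf : ∀ A c, votes L σ w A c ≤ votes L σ w A (f A)) {z : Diagram n × Fin k}
    (hz : f z.1 ≠ z.2) :
    ∃ q : ClassPair k, q.Involves z.2 ∧ signedMargin L σ q (w q) z ≤ 0 := by
  by_contra! hcon
  have hwin : ∀ q : ClassPair k, q.Involves z.2 → pairPredict L σ w q z.1 = z.2 := fun q hq =>
    pairPredict_eq_of_signedMargin_pos hq (hcon q hq)
  have h1 : k - 1 ≤ votes L σ w z.1 z.2 := by
    rw [← card_filter_involves z.2]
    exact Finset.card_le_card (Finset.monotone_filter_right _ fun q _ hq => hwin q hq)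
  have h2 : votes L σ w z.1 (f z.1) < k - 1 := by
    rw [← card_filter_involves (f z.1)]
    refine Finset.card_lt_card (Finset.ssubset_iff_subset_ne.2
      ⟨Finset.monotone_filter_right _ fun q _ hq => ?_, fun heq => ?_⟩)
    · have := pairPredict_involves L σ w q z.1
      rwa [hq] at this
    -- The inclusion is strict because the pair of the predicted and the true class votes for the
    -- true one.
    · have hm : ClassPair.mk (f z.1) z.2 hz ∈
          Finset.univ.filter fun q : ClassPair k => q.Involves (f z.1) := by
        simpa using ClassPair.mk_involves_left hz
      rw [← heq, Finset.mem_filter, hwin _ (ClassPair.mk_involves_right hz)] at hm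
      exact hz hm.2.symm
  have := hf z.1 z.2
  omega

/-- Normalization puts the trained directions in the ball where the margin bound is uniform; `v = 0`
is covered because its normalization is `0`. -/
theorem norm_le_one_of_isMaxMarginSVM {K n k m : ℕ} {L : LandmarkConfig K} {σ : ℝ}
    {S : Sample n k m} {q : ClassPair k} {w : LandmarkRKHS n L σ}
    (h : IsMaxMarginSVM L σ S q w) : ‖w‖ ≤ 1 := by
  obtain ⟨v, -, rfl⟩ := h
  rw [norm_smul, norm_inv, norm_norm]
  exact inv_mul_le_one

/-! ### Class counts -/

theorem minClassCount_le {n k m : ℕ} (S : Sample n k m) (c : Fin k) :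
    minClassCount S ≤ classCount S c := ciInf_le (OrderBot.bddBelow _) c

theorem minClassCount_le_size {n k m : ℕ} (hk : 0 < k) (S : Sample n k m) : minClassCount S ≤ m :=
  (minClassCount_le S ⟨0, hk⟩).trans ((Finset.card_filter_le _ _).trans (by simp))

theorem minClassCount_le_card_pairIndices {n k m : ℕ} (S : Sample n k m) (q : ClassPair k) :
    minClassCount S ≤ (pairIndices S q).card :=
  (minClassCount_le S q.1.1).trans
    (Finset.card_le_card (Finset.monotone_filter_right _ fun _ _ h => Or.inl h))

/-- Double counting: every training point takes part in `k - 1` sub-problems. -/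
theorem sum_card_pairIndices {n k m : ℕ} (S : Sample n k m) :
    ∑ q : ClassPair k, (pairIndices S q).card = m * (k - 1) := by
  have h : ∀ q : ClassPair k, (pairIndices S q).card
      = ∑ i, if q.Involves (S i).2 then 1 else 0 := fun q => by
    rw [← Finset.card_filter]; rfl
  simp only [h]
  rw [Finset.sum_comm]
  simp [card_filter_involves]

/-! ### The one-vs-one ramp loss -/

/-- The weight of the sub-problem `q` at a labelled diagram: `1` if the label takes part in it. -/
def pairWeight {n k : ℕ} (q : ClassPair k) (z : Diagram n × Fin k) : ℝ :=
  if q.Involves z.2 then 1 else 0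

/-- The signed feature of a labelled diagram in the sub-problem `q`, scaled by `1 / ρ`. -/
noncomputable def signedFeature {K n k : ℕ} (L : LandmarkConfig K) (σ ρ : ℝ) (q : ClassPair k)
    (z : Diagram n × Fin k) : LandmarkRKHS n L σ :=
  ((if z.2 = q.1.1 then 1 else -1) / ρ : ℝ) • featureMap L σ z.1

section OneVsOne

variable {K n k m : ℕ} {L : LandmarkConfig K} {σ ρ : ℝ}

theorem pairWeight_nonneg (q : ClassPair k) (z : Diagram n × Fin k) : 0 ≤ pairWeight q z := by
  unfold pairWeight; split <;> norm_num

theorem measurable_pairWeight (q : ClassPair k) :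
    Measurable fun z : Diagram n × Fin k => pairWeight q z :=
  (measurable_of_finite fun c : Fin k => if q.Involves c then (1 : ℝ) else 0).comp measurable_snd

theorem sum_pairWeight_sq (S : Sample n k m) (q : ClassPair k) :
    ∑ i, pairWeight q (S i) ^ 2 = (pairIndices S q).card := by
  simp only [pairWeight, ite_pow, one_pow, ne_eq, OfNat.ofNat_ne_zero, not_false_eq_true, zero_pow,
    Finset.sum_boole]
  rfl

theorem norm_signedFeature_le (hρ : 0 < ρ) (q : ClassPair k) (z : Diagram n × Fin k) :
    ‖signedFeature L σ ρ q z‖ ≤ √(K : ℝ) / ρ := by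
  rw [signedFeature, norm_smul, norm_featureMap, norm_div, Real.norm_of_nonneg hρ.le]
  have : ‖(if z.2 = q.1.1 then 1 else -1 : ℝ)‖ = 1 := by split <;> simp
  rw [this, div_mul_eq_mul_div, one_mul]

theorem inner_signedFeature (q : ClassPair k) (h : LandmarkRKHS n L σ) (z : Diagram n × Fin k) :
    inner ℝ h (signedFeature L σ ρ q z) = signedMargin L σ q h z / ρ := by
  rw [signedFeature, inner_smul_right, signedMargin]
  ring

theorem measurable_inner_signedFeature (q : ClassPair k) (h : LandmarkRKHS n L σ) :
    Measurable fun z : Diagram n × Fin k => (inner ℝ h (signedFeature L σ ρ q z) : ℝ) := by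
  simp only [inner_signedFeature, signedMargin]
  have h1 : Measurable fun A : Diagram n => (inner ℝ h (featureMap L σ A) : ℝ) :=
    (continuous_const.inner (continuous_featureMap L σ)).measurable
  have h2 : Measurable fun c : Fin k => (if c = q.1.1 then 1 else -1 : ℝ) :=
    measurable_of_finite _
  exact ((h2.comp measurable_snd).mul (h1.comp measurable_fst)).div_const ρ

/-- At an error one summand already equals `1`, so the capped loss is `1`, and Markov's inequality
at level `1` concludes. Only an inclusion of events is used, so arbitrary, possibly nonmeasurable,
tie-breaking is harmless. -/
theorem zeroOneRisk_le_integral_cappedLoss (P : Measure (Diagram n × Fin k))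
    [IsProbabilityMeasure P] (hρ : 0 < ρ) {w : ClassPair k → LandmarkRKHS n L σ}
    {f : Diagram n → Fin k} (hf : ∀ A c, votes L σ w A c ≤ votes L σ w A (f A)) :
    zeroOneRisk P f ≤ ∫ z, cappedLoss pairWeight (signedFeature L σ ρ) w z ∂P := by
  have hint : Integrable (cappedLoss pairWeight (signedFeature L σ ρ) w) P :=
    integrable_of_measurable_of_abs_le (M := 1)
      (measurable_cappedLoss measurable_pairWeight measurable_inner_signedFeature w) fun z => by
        rw [abs_of_nonneg (cappedLoss_nonneg pairWeight_nonneg _ _ z)]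
        exact cappedLoss_le_one _ _ _ z
  have h := mul_meas_ge_le_integral_of_nonneg
    (Filter.Eventually.of_forall (cappedLoss_nonneg pairWeight_nonneg _ w)) hint 1
  rw [one_mul] at h
  refine le_trans (measureReal_mono fun z hz => ?_) h
  obtain ⟨q, hq, hm⟩ := exists_signedMargin_nonpos hf hz
  show (1 : ℝ) ≤ min 1 _
  refine le_min le_rfl ?_
  refine le_trans ?_ (Finset.single_le_sum (f := fun q => pairWeight q z *
    ramp (inner ℝ (w q) (signedFeature L σ ρ q z)))
    (fun q _ => mul_nonneg (pairWeight_nonneg q z) (ramp_nonneg _)) (Finset.mem_univ q))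
  simp only [inner_signedFeature]
  rw [ramp_of_nonpos (div_nonpos_of_nonpos_of_nonneg hm hρ.le), pairWeight, if_pos hq, one_mul]

/-- Without the cap, the sum can be taken pair by pair. Each ramp is at most the indicator of a
margin below `ρ`, and the pair losses are weighted by the pair sizes, whose total is `m * (k - 1)`.
-/
theorem sum_cappedLoss_le (hk : 1 ≤ k) (hρ : 0 < ρ) (S : Sample n k m)
    (w : ClassPair k → LandmarkRKHS n L σ) :
    ∑ i, cappedLoss pairWeight (signedFeature L σ ρ) w (S i) ≤
      m * empiricalMarginLoss L σ S ρ w := by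
  have hq : ∀ q : ClassPair k,
      ∑ i, pairWeight q (S i) * ramp (inner ℝ (w q) (signedFeature L σ ρ q (S i))) ≤
        (pairIndices S q).card * ⨆ q : ClassPair k, pairMarginLoss L σ S q ρ (w q) := fun q => by
    have h1 : ∑ i, pairWeight q (S i) * ramp (inner ℝ (w q) (signedFeature L σ ρ q (S i))) ≤
        (((pairIndices S q).filter fun i => signedMargin L σ q (w q) (S i) < ρ).card : ℝ) := by
      rw [Finset.card_filter, pairIndices, Finset.sum_filter, Nat.cast_sum]
      refine Finset.sum_le_sum fun i _ => ?_
      rw [inner_signedFeature]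
      by_cases hi : q.Involves (S i).2
      · rw [pairWeight, if_pos hi, one_mul, if_pos (show _ ∨ _ from hi)]
        split
        · simpa using ramp_le_one _
        · rename_i h
          rw [ramp_of_one_le ((one_le_div hρ).2 (not_lt.1 h))]
          simp
      · rw [pairWeight, if_neg hi, zero_mul]
        exact Nat.cast_nonneg _
    refine h1.trans (le_trans (le_of_eq ?_) (mul_le_mul_of_nonneg_left
      (le_ciSup (f := fun q : ClassPair k => pairMarginLoss L σ S q ρ (w q))
        (Set.finite_range _).bddAbove q) (Nat.cast_nonneg _)))
    simp only [pairMarginLoss]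
    -- For a pair without training points the loss is `0 / 0 = 0`, and both sides vanish.
    rcases Nat.eq_zero_or_pos (pairIndices S q).card with h0 | h0
    · rw [Finset.card_eq_zero] at h0
      simp [h0]
    · field_simp
  calc ∑ i, cappedLoss pairWeight (signedFeature L σ ρ) w (S i)
      ≤ ∑ i, ∑ q, pairWeight q (S i) * ramp (inner ℝ (w q) (signedFeature L σ ρ q (S i))) :=
        Finset.sum_le_sum fun i _ => min_le_right _ _
    _ = ∑ q, ∑ i, pairWeight q (S i) * ramp (inner ℝ (w q) (signedFeature L σ ρ q (S i))) :=
        Finset.sum_comm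
    _ ≤ ∑ q : ClassPair k, ((pairIndices S q).card : ℝ) *
          ⨆ q : ClassPair k, pairMarginLoss L σ S q ρ (w q) := Finset.sum_le_sum fun q _ => hq q
    _ = m * empiricalMarginLoss L σ S ρ w := by
        rw [← Finset.sum_mul, ← Nat.cast_sum, sum_card_pairIndices, empiricalMarginLoss]
        push_cast [hk]
        ring

/-- Each pair size `N` is at least `m_min`, so `√N = N / √N ≤ N / √m_min`; the sizes then sum by
double counting. -/
theorem sum_sqrt_card_pairIndices_le (hk : 1 ≤ k) (S : Sample n k m) (hS : 0 < minClassCount S) :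
    ∑ q : ClassPair k, √((pairIndices S q).card : ℝ) ≤
      m * ((k : ℝ) - 1) / √(minClassCount S : ℝ) := by
  have hS' : 0 < √(minClassCount S : ℝ) := Real.sqrt_pos.2 (by exact_mod_cast hS)
  have h : ((∑ q : ClassPair k, (pairIndices S q).card : ℕ) : ℝ) = m * ((k : ℝ) - 1) := by
    rw [sum_card_pairIndices]; push_cast [hk]; ring
  rw [← h, Nat.cast_sum, Finset.sum_div]
  refine Finset.sum_le_sum fun q _ => ?_
  rw [le_div_iff₀ hS']
  have h1 : √(minClassCount S : ℝ) ≤ √((pairIndices S q).card : ℝ) :=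
    Real.sqrt_le_sqrt (by exact_mod_cast minClassCount_le_card_pairIndices S q)
  exact (mul_le_mul_of_nonneg_left h1 (Real.sqrt_nonneg _)).trans_eq
    (Real.mul_self_sqrt (Nat.cast_nonneg _))

end OneVsOne

/-! ### The risk bound -/

theorem minClassCount_pos_of_le {K n k m : ℕ} (hk : 2 ≤ k) (L : LandmarkConfig K) {γ δ : ℝ}
    (hγ : 0 < γ) (hδ0 : 0 < δ) (hδ1 : δ < 1) {S : Sample n k m}
    (h : 32 * (K : ℝ) * Real.log (4 * (k : ℝ) / δ) / γ ^ 2 ≤ (minClassCount S : ℝ)) :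
    0 < minClassCount S := by
  -- Squared weights summing to `1` force a landmark; with `K = 0` the threshold would be `0` and
  -- give no positivity.
  have hK : 0 < K := by
    rcases Nat.eq_zero_or_pos K with rfl | hK
    · simpa using L.sum_weight_sq
    · exact hK
  have hk' : (2 : ℝ) ≤ k := by exact_mod_cast hk
  have hlog : 0 < Real.log (4 * (k : ℝ) / δ) := Real.log_pos (by rw [lt_div_iff₀ hδ0]; linarith)
  have : (0 : ℝ) < minClassCount S := lt_of_lt_of_le (by positivity) h
  exact_mod_cast this

/-- The event `G` is fixed before `w` and `f`, so it covers all SVM variants, penalties and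
tie-breaking rules at once. The threshold is a condition on the sample in `G`, as the class counts
are random. -/
theorem theorem3p1 :
    ∃ C : ℝ, 0 < C ∧
      ∀ (K n k m : ℕ), 2 ≤ k →
      ∀ (L : LandmarkConfig K) (σ : ℝ), 0 < σ →
      ∀ (P : Measure (Diagram n × Fin k)) [IsProbabilityMeasure P],
        (∀ c : Fin k, P {z | z.2 = c} ≠ 0) →
        0 < kernelMargin L σ P →
      ∀ δ : ℝ, 0 < δ → δ < 1 →
      ∃ G : Set (Sample n k m), MeasurableSet G ∧
        ENNReal.ofReal (1 - δ) ≤ Measure.pi (fun _ : Fin m => P) G ∧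
        ∀ S ∈ G,
          32 * (K : ℝ) * Real.log (4 * (k : ℝ) / δ) / kernelMargin L σ P ^ 2
            ≤ (minClassCount S : ℝ) →
          ∀ (w : ClassPair k → LandmarkRKHS n L σ) (f : Diagram n → Fin k),
            IsOvOSVM L σ S w f →
            zeroOneRisk P f ≤
              empiricalMarginLoss L σ S (kernelMargin L σ P / 2) w
                + 4 * ((k : ℝ) - 1) * √(K : ℝ) /
                    (kernelMargin L σ P * √(minClassCount S : ℝ))
                + C * √(Real.log ((k : ℝ) / δ) / (minClassCount S : ℝ)) := by
  -- The constant is the McDiarmid increment.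
  refine ⟨3, by norm_num, fun K n k m hk L σ _ P _ _ hγ δ hδ0 hδ1 => ?_⟩
  set γ := kernelMargin L σ P
  -- The concentration step needs a nonempty sample; for `m = 0` the threshold contradicts `m_min ≤
  -- m`.
  rcases Nat.eq_zero_or_pos m with rfl | hm
  · refine ⟨Set.univ, MeasurableSet.univ, ?_, fun S _ hS => ?_⟩
    · rw [measure_univ, ← ENNReal.ofReal_one]
      exact ENNReal.ofReal_le_ofReal (by linarith)
    · have h1 := minClassCount_pos_of_le hk L hγ hδ0 hδ1 hS
      have h2 := minClassCount_le_size (by omega) S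
      omega
  have hρ : 0 < γ / 2 := by positivity
  obtain ⟨G, hGm, hG, hGS⟩ := exists_uniform_margin_event (P := P) hm
    (u := fun (q : ClassPair k) (z : Diagram n × Fin k) => pairWeight q z)
    (v := signedFeature L σ (γ / 2)) pairWeight_nonneg
    measurable_pairWeight (norm_signedFeature_le hρ) measurable_inner_signedFeature hδ0 hδ1
  refine ⟨G, hGm, hG, fun S hSG hS w f hwf => ?_⟩
  have hmin := minClassCount_pos_of_le hk L hγ hδ0 hδ1 hS
  have hbound := hGS S hSG w fun q => norm_le_one_of_isMaxMarginSVM (hwf.maxMargin q)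
  have hrisk := zeroOneRisk_le_integral_cappedLoss P hρ hwf.majority
  have hemp := sum_cappedLoss_le (by omega) hρ S w
  have hsqrt := sum_sqrt_card_pairIndices_le (by omega) S hmin
  simp only [sum_pairWeight_sq] at hbound
  have hm' : (0 : ℝ) < m := by exact_mod_cast hm
  have hmin' : (0 : ℝ) < minClassCount S := by exact_mod_cast hmin
  have hk' : (2 : ℝ) ≤ k := by exact_mod_cast hk
  -- The `4` is the symmetrization factor `2` times the `2` from the margin scale `γ / 2`.
  have hcomplexity : 2 * (√(K : ℝ) / (γ / 2)) * ∑ q : ClassPair k, √((pairIndices S q).card : ℝ) ≤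
      m * (4 * ((k : ℝ) - 1) * √(K : ℝ) / (γ * √(minClassCount S : ℝ))) := by
    refine (mul_le_mul_of_nonneg_left hsqrt (by positivity)).trans_eq ?_
    field_simp
    ring
  have hlog : 0 ≤ Real.log (1 / δ) := Real.log_nonneg (by rw [le_div_iff₀ hδ0]; linarith)
  have hlog' : Real.log (1 / δ) ≤ Real.log (k / δ) :=
    Real.log_le_log (by positivity) (by gcongr; linarith)
  -- Here `1 ≤ k` enlarges the logarithm and `m_min ≤ m` weakens the rate from `m` to `m_min`;
  -- everything is still multiplied by `m`.
  have hdev : √(m * Real.log (1 / δ) / 2) ≤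
      m * √(Real.log ((k : ℝ) / δ) / (minClassCount S : ℝ)) := by
    refine Real.sqrt_le_iff.2 ⟨by positivity, ?_⟩
    rw [mul_pow, Real.sq_sqrt (div_nonneg (hlog.trans hlog') hmin'.le)]
    have hle : (minClassCount S : ℝ) ≤ m := by
      exact_mod_cast minClassCount_le_size (by omega) S
    rw [← mul_div_assoc, le_div_iff₀ hmin']
    calc m * Real.log (1 / δ) / 2 * minClassCount S ≤ m * Real.log (k / δ) * m := by
          refine mul_le_mul ?_ hle hmin'.le (mul_nonneg hm'.le (hlog.trans hlog'))
          nlinarith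
      _ = _ := by ring
  refine hrisk.trans (le_of_mul_le_mul_left (hbound.trans ?_) hm')
  rw [mul_add, mul_add]
  linarith
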